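/- Let $\mathbb N=\{0,1,2,\dots\}$, let $a,c$ be real numbers with $0<a<1$ and $c\neq 0,-1,-2,\dots$, and let $\mathcal F=(F_1,F_2)$ be a pair of finite sets of positive integers, not both empty. Write $k_i=|F_i|$, $k=k_1+k_2$, $$u_{\mathcal F}=\sum_{f\in F_1}f+\sum_{f\in F_2}f-\binom{k_1+1}{2}-\binom{k_2}{2},\qquad \sigma_{\mathcal F}=\{u_{\mathcal F},u_{\mathcal F}+1,\dots\}\setminus\{u_{\mathcal F}+f: f\in F_1\}.$$ For $b\ne 0,1$ let $m_n^{b,c}(x)=\frac{b^n}{(1-b)^n}\sum_{j=0}^n b^{-j}\binom{x}{j}\binom{-x-c}{n-j}$ be the Meixner polynomials. Let $\Omega_{\mathcal F}^{a,c}(x)$ be the $k\times k$ determinant whose rows are $\big(m_f^{a,c}(x+j)\big)_{0\le j\le k-1}$ for $f\in F_1$, followed by $\big(m_f^{1/a,c}(x+j)/a^j\big)_{0\le j\le k-1}$ for $f\in F_2$ (each set in increasing order). For $n\in\sigma_{\mathcal F}$ let $m_n^{a,c;\mathcal F}(x)$ be the $(k+1)\times(k+1)$ determinant whose rows are $\big(m_{n-u_{\mathcal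 F}}^{a,c}(x+j)\big)_{0\le j\le k}$, then $\big(m_f^{a,c}(x+j)\big)_{0\le j\le k}$ for $f\in F_1$, then $\big(m_f^{1/a,c}(x+j)/a^j\big)_{0\le j\le k}$ for $f\in F_2$. Assume that $c$ and $\mathcal F$ are admissible: with $\hat c=\max\{-\lfloor c\rfloor,0\}$ and $(y)_r=y(y+1)\cdots(y+r-1)$, $$\frac{\prod_{f\in F_1}(x-f)\prod_{f\in F_2}(x+c+f)}{(x+c)_{\hat c}}\ge 0\qquad\text{for all } x\in\mathbb N.$$ Then every mass of the measure $$\omega_{a,c}^{\mathcal F}=\sum_{x=0}^\infty\frac{a^x\,\Gamma(x+c+k)}{x!\,\Omega_{\mathcal F}^{a,c}(x)\,\Omega_{\mathcal F}^{a,c}(x+1)}\,\delta_x$$ is positive, the polynomials $m_n^{a,c;\mathcal F}$, $n\in\sigma_{\mathcal F}$, belong to $L^2(\omega_{a,c}^{\mathcal F})$, and their linear combinations are dense in $L^2(\omega_{a,c}^{\mathcal F})$ (for real as well as for complex scalars). Moreover $\omega_{a,c}^{\mathcal F}$ has finite moments of every order and these polynomials are orthogonal, with positive norms, with respect to it. Hence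 they are exceptional Meixner polynomials, that is, they are orthogonal and complete with respect to a positive measure. Their norms are given by $$\int \big(m_r^{a,c;\mathcal F}\big)^2\,d\omega_{a,c}^{\mathcal F}=\frac{a^{k_1-2k}}{(1-a)^{c+2r-2u_{\mathcal F}-k}}\,\rho_{a,c}^{\mathcal F}(r),\qquad r\in\sigma_{\mathcal F},$$ where $$\rho_{a,c}^{\mathcal F}(r)=\prod_{f\in F_1}(r-f-u_{\mathcal F})\prod_{f\in F_2}(r+c+f-u_{\mathcal F})\,\frac{a^{r-u_{\mathcal F}}\,\Gamma(r+c-u_{\mathcal F})}{(r-u_{\mathcal F})!}.$$ -/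

import Mathlib

open Polynomial MeasureTheory

noncomputable section

namespace ExceptionalMeixner

/-- The generalized binomial coefficient `binom(p, j) = p (p - 1) ⋯ (p - j + 1) / j!`
of a real polynomial `p`. -/
def binom (p : ℝ[X]) (j : ℕ) : ℝ[X] :=
  C ((j.factorial : ℝ)⁻¹) * (descPochhammer ℝ j).comp p

/-- The Meixner polynomial
`m_n^{a,c}(x) = (a^n / (1-a)^n) ∑_{j=0}^n a^{-j} binom(x, j) binom(-x-c, n-j)`. -/
def meixner (a c : ℝ) (n : ℕ) : ℝ[X] :=
  C (a ^ n / (1 - a) ^ n) *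
    ∑ j ∈ Finset.range (n + 1), C ((a ^ j)⁻¹) * binom X j * binom (-X - C c) (n - j)

/-- The number `u_F`. For sets of positive integers the natural subtractions do not truncate. -/
def uF (F₁ F₂ : Finset ℕ) : ℕ :=
  (∑ f ∈ F₁, f) + (∑ f ∈ F₂, f) - (F₁.card + 1).choose 2 - F₂.card.choose 2

/-- The index set `σ_F = {u_F, u_F + 1, …} \ {u_F + f : f ∈ F₁}`. -/
def sigmaF (F₁ F₂ : Finset ℕ) : Set ℕ :=
  {n | uF F₁ F₂ ≤ n ∧ ∀ f ∈ F₁, n ≠ uF F₁ F₂ + f}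

/-- The row `m_n^{a,c}(x), m_n^{a,c}(x+1), m_n^{a,c}(x+2), …`. -/
def row₁ (a c : ℝ) (n : ℕ) (j : ℕ) : ℝ[X] :=
  (meixner a c n).comp (X + C (j : ℝ))

/-- The row `m_f^{1/a,c}(x), m_f^{1/a,c}(x+1)/a, m_f^{1/a,c}(x+2)/a^2, …`. -/
def row₂ (a c : ℝ) (f : ℕ) (j : ℕ) : ℝ[X] :=
  C ((a ^ j)⁻¹) * (meixner (1 / a) c f).comp (X + C (j : ℝ))

/-- The rows indexed by `F₁` followed by the rows indexed by `F₂`, each set being listed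
in increasing order. -/
def rowsF (a c : ℝ) (F₁ F₂ : Finset ℕ) : Fin (F₁.card + F₂.card) → ℕ → ℝ[X] :=
  Fin.append (fun i => row₁ a c (F₁.orderEmbOfFin rfl i))
    (fun i => row₂ a c (F₂.orderEmbOfFin rfl i))

/-- The `k × k` Casorati determinant `Ω_F^{a,c}`, where `k = |F₁| + |F₂|`. -/
def Omega (a c : ℝ) (F₁ F₂ : Finset ℕ) : ℝ[X] :=
  Matrix.det (Matrix.of fun i j : Fin (F₁.card + F₂.card) => rowsF a c F₁ F₂ i (j : ℕ))

/-- The polynomial `m_n^{a,c;F}`, a `(k+1) × (k+1)` Casorati determinant whose first row comes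
from `m_{n-u_F}^{a,c}`. It is meant for `n ∈ σ_F` only. -/
def excMeixner (a c : ℝ) (F₁ F₂ : Finset ℕ) (n : ℕ) : ℝ[X] :=
  Matrix.det (Matrix.of fun i j : Fin (F₁.card + F₂.card + 1) =>
    (Fin.cons (row₁ a c (n - uF F₁ F₂)) (rowsF a c F₁ F₂) :
      Fin (F₁.card + F₂.card + 1) → ℕ → ℝ[X]) i (j : ℕ))

/-- Admissibility of `c` and `F = (F₁, F₂)`. Here `(-⌊c⌋).toNat = max (-⌊c⌋) 0`, and
`(ascPochhammer ℝ r).eval y` is the rising factorial `(y)_r`. -/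
def Admissible (c : ℝ) (F₁ F₂ : Finset ℕ) : Prop :=
  ∀ x : ℕ, 0 ≤ ((∏ f ∈ F₁, ((x : ℝ) - f)) * ∏ f ∈ F₂, ((x : ℝ) + c + f)) /
    (ascPochhammer ℝ (-⌊c⌋).toNat).eval ((x : ℝ) + c)

/-- The mass at the nonnegative integer `x` of the discrete measure `ω_{a,c}^F`. -/
def omegaMass (a c : ℝ) (F₁ F₂ : Finset ℕ) (x : ℕ) : ℝ :=
  a ^ x * Real.Gamma ((x : ℝ) + c + ((F₁.card + F₂.card : ℕ) : ℝ)) /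
    ((x.factorial : ℝ) * (Omega a c F₁ F₂).eval (x : ℝ) * (Omega a c F₁ F₂).eval ((x : ℝ) + 1))

/-- The discrete measure `ω_{a,c}^F = ∑_x omegaMass x • δ_x` (when all masses are nonnegative). -/
def omegaMeasure (a c : ℝ) (F₁ F₂ : Finset ℕ) : Measure ℝ :=
  Measure.sum fun x : ℕ => ENNReal.ofReal (omegaMass a c F₁ F₂ x) • Measure.dirac (x : ℝ)

/-- The mass at the integer `r ≥ u_F` of the Christoffel transform `ρ_{a,c}^F` of the
Meixner measure, translated by `u_F`. -/
def rhoMass (a c : ℝ) (F₁ F₂ : Finset ℕ) (r : ℕ) : ℝ :=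
  (∏ f ∈ F₁, ((r : ℝ) - f - uF F₁ F₂)) * (∏ f ∈ F₂, ((r : ℝ) + c + f - uF F₁ F₂)) *
    (a ^ (r - uF F₁ F₂) * Real.Gamma ((r : ℝ) + c - uF F₁ F₂) / ((r - uF F₁ F₂).factorial : ℝ))

/-- The polynomials `p n`, `n ∈ S`, are orthogonal, with positive norms, with respect to the
positive measure `μ`, which has finite moments of every order. -/
structure IsOrthogonalFamily (μ : Measure ℝ) (S : Set ℕ) (p : ℕ → ℝ[X]) : Prop where
  moments : ∀ j : ℕ, Integrable (fun t : ℝ => t ^ j) μ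
  orthogonal : ∀ n ∈ S, ∀ m ∈ S, n ≠ m → ∫ t, (p n).eval t * (p m).eval t ∂μ = 0
  norm_pos : ∀ n ∈ S, 0 < ∫ t, (p n).eval t ^ 2 ∂μ

/-- The polynomials `p n`, `n ∈ S`, belong to the space `L²(μ)` of `𝕜`-valued functions and their
linear combinations are dense in it. -/
def IsCompleteFamily (𝕜 : Type*) [RCLike 𝕜] (μ : Measure ℝ) (S : Set ℕ) (p : ℕ → ℝ[X]) : Prop :=
  ∃ h : ∀ n : S, MemLp (fun t : ℝ => (((p n).eval t : ℝ) : 𝕜)) 2 μ,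
    Dense (Submodule.span 𝕜 (Set.range fun n : S => (h n).toLp) : Set (Lp 𝕜 2 μ))

/-- `m_n^{a,c;F}`, `n ∈ σ_F`, are exceptional Meixner polynomials: they are orthogonal and
complete with respect to some positive measure. -/
def IsExceptionalMeixner (a c : ℝ) (F₁ F₂ : Finset ℕ) : Prop :=
  ∃ μ : Measure ℝ, IsOrthogonalFamily μ (sigmaF F₁ F₂) (excMeixner a c F₁ F₂) ∧
    IsCompleteFamily ℝ μ (sigmaF F₁ F₂) (excMeixner a c F₁ F₂)

end ExceptionalMeixner

end

/-! Degree and variable trade places. For natural n and x the normalization h_n = `hypMeixner a c n`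
satisfies h_n(x) = h_x(n), and Pfaff's transformation turns m_f^{1/a,c}(x) into a multiple of a^x
h_x(-c-f). Hence at a natural number x, `Omega` is, up to an explicit factor, the Casorati
determinant of h_x, ..., h_{x+k-1} at the nodes f (f ∈ F₁) and -c-f (f ∈ F₂), while the exceptional
polynomial of index u_F + r is Christoffel's determinant with degree index x, evaluated at r.

Christoffel's formula writes that determinant as ∏(r - z_i) q_x(r), where the q_x are orthogonal for
v, the Meixner weight times ∏(r - z_i). Admissibility says that v is nonnegative on ℕ; it vanishes
exactly on F₁. The norm of q_x contains the Casorati determinants at x and x + 1, so the mass of ω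
at x is a positive constant divided by the squared row factor and ‖q_x‖² (`exists_dual_family`).
This gives the positivity of the masses.

Because v decays exponentially, polynomials are dense in ℓ²(v), so the normalized q_n form a Hilbert
basis and the matrix q_n(r) √v(r) / ‖q_n‖ is unitary. Its columns r ∉ F₁, as sequences in n, are the
exceptional polynomials times the square root of the mass, up to constants. Their orthogonality and
norms (`hasSum_dual`) come from the completeness of the q_n; their completeness (`eq_zero_of_dual`)
comes from the orthonormality of the q_n. -/

noncomputable section

namespace ExceptionalMeixner

/-! ### Rising factorials -/

/-- The rising factorial `(c)_n = c (c + 1) ⋯ (c + n - 1)`. -/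
def poch (c : ℝ) (n : ℕ) : ℝ := (ascPochhammer ℝ n).eval c

@[simp] lemma poch_zero (c : ℝ) : poch c 0 = 1 := by simp [poch]

lemma poch_succ (c : ℝ) (n : ℕ) : poch c (n + 1) = poch c n * (c + n) := by
  simp [poch, ascPochhammer_succ_eval]

lemma poch_succ_left (c : ℝ) (n : ℕ) : poch c (n + 1) = c * poch (c + 1) n := by
  simp [poch, ascPochhammer_succ_left]

lemma poch_add (c : ℝ) (m n : ℕ) : poch c (m + n) = poch c m * poch (c + m) n := by
  induction n with
  | zero => simp
  | succ n ih => rw [← add_assoc, poch_succ, ih, poch_succ]; push_cast; ring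

lemma poch_ne_zero {c : ℝ} (hc : ∀ j : ℕ, c ≠ -(j : ℝ)) (n : ℕ) : poch c n ≠ 0 := by
  induction n with
  | zero => simp
  | succ n ih =>
    rw [poch_succ]
    exact mul_ne_zero ih fun h => hc n (by linarith)

lemma ne_neg_nat_add {c : ℝ} (hc : ∀ j : ℕ, c ≠ -(j : ℝ)) (n : ℕ) (j : ℕ) :
    c + n ≠ -(j : ℝ) := fun h => hc (n + j) (by push_cast; linarith)

lemma Gamma_add_nat {c : ℝ} (hc : ∀ j : ℕ, c ≠ -(j : ℝ)) (n : ℕ) :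
    Real.Gamma (c + n) = Real.Gamma c * poch c n := by
  induction n with
  | zero => simp
  | succ n ih =>
    rw [poch_succ, Nat.cast_succ, ← add_assoc, Real.Gamma_add_one (fun h => hc n (by linarith)), ih]
    ring

/-! ### Meixner polynomials and their duality -/

lemma multichoose_eq_poch (c : ℝ) (n : ℕ) :
    Ring.multichoose c n = poch c n / n.factorial := by
  have h := Ring.factorial_nsmul_multichoose_eq_ascPochhammer c n
  rw [ascPochhammer_smeval_eq_eval, nsmul_eq_mul] at h
  rw [eq_div_iff (by positivity), mul_comm, h, poch]

lemma choose_neg_eq_poch (c : ℝ) (n : ℕ) :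
    Ring.choose (-c) n = (-1) ^ n * (poch c n / n.factorial) := by
  rw [Ring.choose_neg', multichoose_eq_poch, Units.smul_def, Int.coe_negOnePow_natCast]
  simp

lemma descPochhammer_eval_eq_choose (x : ℝ) (n : ℕ) :
    (descPochhammer ℝ n).eval x = n.factorial * Ring.choose x n := by
  have h := Ring.descPochhammer_eq_factorial_smul_choose x n
  rw [nsmul_eq_mul] at h
  rw [← h, ← descPochhammer_map (Int.castRingHom ℝ), eval_map, ← algebraMap_int_eq, ← aeval_def,
    aeval_eq_smeval]

lemma eval_binom (p : ℝ[X]) (j : ℕ) (x : ℝ) :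
    (binom p j).eval x = Ring.choose (p.eval x) j := by
  rw [binom, eval_mul, eval_C, eval_comp, descPochhammer_eval_eq_choose,
    inv_mul_cancel_left₀ (by positivity)]

/-- The Meixner polynomial `₂F₁(-n, -x; c; 1 - 1/a)` in the hypergeometric normalization. -/
def hypMeixner (a c : ℝ) (n : ℕ) : ℝ[X] :=
  ∑ i ∈ Finset.range (n + 1),
    C ((n.choose i : ℝ) * (1 - 1 / a) ^ i / poch c i) * descPochhammer ℝ i

lemma eval_hypMeixner (a c : ℝ) (n : ℕ) (x : ℝ) :
    (hypMeixner a c n).eval x = ∑ i ∈ Finset.range (n + 1),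
      (n.choose i : ℝ) * (1 - 1 / a) ^ i / poch c i * (descPochhammer ℝ i).eval x := by
  simp [hypMeixner, eval_finsetSum]

/-- Trinomial revision pulls out `Ring.choose x i`, and Vandermonde's identity sums the rest, as (x
- i) + (-x - c) = -(c + i). -/
lemma sum_choose_mul_choose (x c : ℝ) {n i : ℕ} (hi : i ≤ n) :
    ∑ j ∈ Finset.range (n + 1), (j.choose i : ℝ) * (Ring.choose x j * Ring.choose (-x - c) (n - j)) =
      Ring.choose x i * Ring.choose (-(c + i)) (n - i) := by
  obtain ⟨m, rfl⟩ := Nat.exists_eq_add_of_le hi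
  rw [show i + m + 1 = i + (m + 1) by ring, Finset.sum_range_add, Finset.sum_eq_zero, zero_add]
  · rw [Nat.add_sub_cancel_left,
      show -(c + (i : ℝ)) = (x - i) + (-x - c) by ring,
      Ring.add_choose_eq m (Commute.all _ _), Finset.Nat.sum_antidiagonal_eq_sum_range_succ_mk,
      Finset.mul_sum]
    refine Finset.sum_congr rfl fun j _ => ?_
    have h := Ring.choose_smul_choose x (Nat.le_add_right i j)
    rw [nsmul_eq_mul, Nat.add_sub_cancel_left] at h
    rw [← mul_assoc, h, mul_assoc, show i + m - (i + j) = m - j by omega]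
  · intro j hj
    rw [Nat.choose_eq_zero_of_lt (Finset.mem_range.1 hj)]
    simp

/-- The ratio between the two normalizations of the Meixner polynomials. -/
def normFactor (a c : ℝ) (n : ℕ) : ℝ := (a / (a - 1)) ^ n * (poch c n / n.factorial)

lemma normFactor_ne_zero {a c : ℝ} (ha₀ : a ≠ 0) (ha₁ : a ≠ 1) (hc : ∀ j : ℕ, c ≠ -(j : ℝ))
    (n : ℕ) : normFactor a c n ≠ 0 :=
  mul_ne_zero (pow_ne_zero _ (div_ne_zero ha₀ (sub_ne_zero.2 ha₁)))
    (div_ne_zero (poch_ne_zero hc n) (by positivity))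

/-- Expanding a^{-j} = ((1/a - 1) + 1)^j and exchanging the sums leaves the inner sums of
`sum_choose_mul_choose`, which are the hypergeometric coefficients. -/
lemma eval_meixner {a c : ℝ} (ha₀ : a ≠ 0) (ha₁ : a ≠ 1) (hc : ∀ j : ℕ, c ≠ -(j : ℝ)) (n : ℕ)
    (x : ℝ) : (meixner a c n).eval x = normFactor a c n * (hypMeixner a c n).eval x := by
  have h1 : (1 - a) ≠ 0 := sub_ne_zero.2 (Ne.symm ha₁)
  have h2 : (a - 1) ≠ 0 := sub_ne_zero.2 ha₁
  have hpow : ∀ j ∈ Finset.range (n + 1),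
      (a ^ j)⁻¹ = ∑ i ∈ Finset.range (n + 1), (1 / a - 1) ^ i * (j.choose i : ℝ) := by
    intro j hj
    have hj' : j + 1 ≤ n + 1 := by have := Finset.mem_range.1 hj; omega
    rw [← inv_pow, show a⁻¹ = (1 / a - 1) + 1 by rw [one_div]; ring, add_pow,
      ← Finset.sum_subset (Finset.range_mono hj')]
    · simp
    · intro i _ hi
      rw [Nat.choose_eq_zero_of_lt (by simpa using hi)]
      simp
  rw [eval_hypMeixner, meixner, eval_mul, eval_C, eval_finsetSum]
  simp only [eval_mul, eval_C, eval_binom, eval_X, eval_sub, eval_neg]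
  have : ∑ j ∈ Finset.range (n + 1), (a ^ j)⁻¹ * Ring.choose x j * Ring.choose (-x - c) (n - j) =
      ∑ i ∈ Finset.range (n + 1),
        (1 / a - 1) ^ i * (Ring.choose x i * Ring.choose (-(c + i)) (n - i)) := by
    calc _ = ∑ j ∈ Finset.range (n + 1), ∑ i ∈ Finset.range (n + 1), (1 / a - 1) ^ i *
          ((j.choose i : ℝ) * (Ring.choose x j * Ring.choose (-x - c) (n - j))) := by
          refine Finset.sum_congr rfl fun j hj => ?_
          rw [hpow j hj, Finset.sum_mul, Finset.sum_mul]
          exact Finset.sum_congr rfl fun i _ => by ring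
      _ = _ := by
          rw [Finset.sum_comm]
          refine Finset.sum_congr rfl fun i hi => ?_
          rw [← Finset.mul_sum, sum_choose_mul_choose x c (by simpa [Nat.lt_succ_iff] using hi)]
  rw [this, Finset.mul_sum, Finset.mul_sum]
  refine Finset.sum_congr rfl fun i hi => ?_
  obtain ⟨m, rfl⟩ := Nat.exists_eq_add_of_le (show i ≤ n by simpa [Nat.lt_succ_iff] using hi)
  rw [choose_neg_eq_poch, descPochhammer_eval_eq_choose, Nat.add_sub_cancel_left, normFactor,
    poch_add, Nat.choose_eq_factorial_div_factorial (Nat.le_add_right i m), Nat.add_sub_cancel_left,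
    Nat.cast_div (Nat.factorial_mul_factorial_dvd_factorial_add i m) (by positivity)]
  have hp := poch_ne_zero hc i
  have e1 : a ^ (i + m) / (1 - a) ^ (i + m) = (a / (a - 1)) ^ (i + m) * (-1) ^ (i + m) := by
    rw [← div_pow, ← mul_pow]
    congr 1
    rw [div_mul_eq_mul_div, div_eq_div_iff h1 h2]; ring
  have e2 : (1 / a - 1) ^ i = (-1) ^ i * (1 - 1 / a) ^ i := by rw [← mul_pow]; congr 1; ring
  have e3 : ((-1 : ℝ)) ^ (i + m) * (-1) ^ i * (-1) ^ m = 1 := by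
    rw [← pow_add, ← pow_add]; exact Even.neg_one_pow ⟨i + m, by ring⟩
  rw [e1, e2]
  have hi0 : (i.factorial : ℝ) ≠ 0 := by positivity
  have hm0 : (m.factorial : ℝ) ≠ 0 := by positivity
  have hn0 : ((i + m).factorial : ℝ) ≠ 0 := by positivity
  push_cast
  calc _ = ((-1 : ℝ) ^ (i + m) * (-1) ^ i * (-1) ^ m) * ((a / (a - 1)) ^ (i + m) *
        ((1 - 1 / a) ^ i * (Ring.choose x i * (poch (c + i) m / m.factorial)))) := by ring
    _ = _ := by
      rw [e3, one_mul]; field_simp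

/-- At a natural x the terms with i > x vanish, and what remains is symmetric in n and x;
self-duality can be read off. -/
lemma eval_hypMeixner_natCast (a c : ℝ) (n x : ℕ) :
    (hypMeixner a c n).eval (x : ℝ) = ∑ i ∈ Finset.range (min n x + 1),
      (n.choose i : ℝ) * (1 - 1 / a) ^ i / poch c i * (i.factorial * (x.choose i : ℝ)) := by
  rw [eval_hypMeixner, ← Finset.sum_subset (Finset.range_mono
    (Nat.succ_le_succ (min_le_left n x)))]
  · refine Finset.sum_congr rfl fun i _ => ?_
    rw [descPochhammer_eval_eq_choose, Ring.choose_natCast]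
  · intro i hi hi'
    simp only [Finset.mem_range] at hi hi'
    rw [descPochhammer_eval_eq_choose, Ring.choose_natCast,
      Nat.choose_eq_zero_of_lt (show x < i by omega)]
    simp

/-- Self-duality of the Meixner polynomials. -/
lemma hypMeixner_duality (a c : ℝ) (n x : ℕ) :
    (hypMeixner a c n).eval (x : ℝ) = (hypMeixner a c x).eval (n : ℝ) := by
  rw [eval_hypMeixner_natCast, eval_hypMeixner_natCast, min_comm]
  exact Finset.sum_congr rfl fun i _ => by ring

/-- Pascal's rule under the summation sign, with the complementary index kept as a second argument
of `g`; it drives the induction in `pfaff`. -/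
lemma sum_range_choose_succ (x : ℕ) (g : ℕ → ℕ → ℝ) :
    ∑ i ∈ Finset.range (x + 1 + 1), ((x + 1).choose i : ℝ) * g i (x + 1 - i) =
      ∑ i ∈ Finset.range (x + 1), (x.choose i : ℝ) * (g i (x - i + 1) + g (i + 1) (x - i)) := by
  rw [← Finset.Nat.sum_antidiagonal_eq_sum_range_succ
      (fun i j => ((x + 1).choose i : ℝ) * g i j) (x + 1),
    Finset.sum_antidiagonal_choose_succ_mul,
    Finset.Nat.sum_antidiagonal_eq_sum_range_succ (fun i j => (x.choose i : ℝ) * g i (j + 1)),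
    Finset.Nat.sum_antidiagonal_eq_sum_range_succ (fun i j => (x.choose j : ℝ) * g (i + 1) j),
    ← Finset.sum_add_distrib]
  refine Finset.sum_congr rfl fun i hi => ?_
  rw [Nat.choose_symm (by simpa [Nat.lt_succ_iff] using hi), mul_add]

/-- Pfaff's transformation of a terminating hypergeometric series. -/
lemma pfaff (b : ℝ) (x : ℕ) : ∀ (f c : ℝ), (∀ j : ℕ, c ≠ -(j : ℝ)) →
    ∑ i ∈ Finset.range (x + 1), (x.choose i : ℝ) *
        ((1 - b) ^ i / poch c i * (descPochhammer ℝ i).eval f) =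
      ∑ i ∈ Finset.range (x + 1), (x.choose i : ℝ) *
        (b ^ (x - i) * (1 - b) ^ i * (poch (c + f) i / poch c i)) := by
  induction x with
  | zero => intro f c _; simp
  | succ x ih =>
    intro f c hc
    have hc0 : c ≠ 0 := by simpa using hc 0
    have hc1 : ∀ j : ℕ, c + 1 ≠ -(j : ℝ) := by
      have := ne_neg_nat_add hc 1; simpa using this
    have hL := sum_range_choose_succ x
      (fun i _ => (1 - b) ^ i / poch c i * (descPochhammer ℝ i).eval f)
    have hR := sum_range_choose_succ x
      (fun i j => b ^ j * (1 - b) ^ i * (poch (c + f) i / poch c i))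
    simp only [mul_add] at hL hR
    rw [hL, hR, Finset.sum_add_distrib, Finset.sum_add_distrib, ih f c hc]
    -- The second half of the left side is (1-b)f/c times the same sum at (f-1, c+1), which is why
    -- the induction runs over all f and c. The shift preserves c + f, so both sides can then be
    -- compared term by term.
    have key := congrArg (fun t => (1 - b) * f / c * t) (ih (f - 1) (c + 1) hc1)
    simp only [Finset.mul_sum] at key
    have hL' : ∑ i ∈ Finset.range (x + 1), (x.choose i : ℝ) *
        ((1 - b) ^ (i + 1) / poch c (i + 1) * (descPochhammer ℝ (i + 1)).eval f) =
        ∑ i ∈ Finset.range (x + 1), (1 - b) * f / c * ((x.choose i : ℝ) *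
        ((1 - b) ^ i / poch (c + 1) i * (descPochhammer ℝ i).eval (f - 1))) := by
      refine Finset.sum_congr rfl fun i _ => ?_
      have := poch_ne_zero hc1 i
      rw [poch_succ_left, descPochhammer_succ_left, eval_mul, eval_X, eval_comp, eval_sub, eval_X,
        eval_one]
      field_simp
      ring
    rw [hL', key, ← Finset.sum_add_distrib, ← Finset.sum_add_distrib]
    refine Finset.sum_congr rfl fun i _ => ?_
    have h1 := poch_ne_zero hc1 i
    have h2 := poch_ne_zero hc i
    have h3 : c + i ≠ 0 := fun h => hc i (by linarith)
    have e : poch (c + 1) i = poch c i * (c + i) / c := by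
      rw [eq_div_iff hc0, ← poch_succ, poch_succ_left, mul_comm]
    rw [show c + 1 + (f - 1) = c + f by ring, poch_succ, poch_succ, e]
    field_simp
    ring

/-- Duality makes x the degree, and Pfaff's transformation then replaces 1/a by a and f by -c-f.
Thus the rows from F₂ involve the same polynomials as those from F₁, only at other nodes. -/
lemma eval_hypMeixner_inv {a c : ℝ} (ha₀ : a ≠ 0) (hc : ∀ j : ℕ, c ≠ -(j : ℝ)) (f x : ℕ) :
    (hypMeixner (1 / a) c f).eval (x : ℝ) = a ^ x * (hypMeixner a c x).eval (-c - f) := by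
  rw [hypMeixner_duality, eval_hypMeixner, eval_hypMeixner, Finset.mul_sum]
  have h := pfaff a x f c hc
  rw [one_div_one_div]
  calc _ = _ := Finset.sum_congr rfl fun i _ => by ring
    _ = _ := h
    _ = _ := by
      refine Finset.sum_congr rfl fun i hi => ?_
      obtain ⟨m, rfl⟩ := Nat.exists_eq_add_of_le (show i ≤ x by simpa [Nat.lt_succ_iff] using hi)
      have hp := poch_ne_zero hc i
      rw [show -c - (f : ℝ) = -(c + f) by ring, descPochhammer_eval_eq_choose, choose_neg_eq_poch,
        Nat.add_sub_cancel_left, show (1 - a) = (-1) * (1 - 1 / a) * a by field_simp; ring,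
        mul_pow, mul_pow, pow_add]
      field_simp

/-! ### Exponentially decaying sequences -/

/-- Sequences that are bounded by a decaying geometric sequence. -/
def ExpDecay (t : ℕ → ℝ) : Prop := ∃ K r : ℝ, 0 < r ∧ r < 1 ∧ ∀ x, |t x| ≤ K * r ^ x

lemma Summable.exists_abs_le {u : ℕ → ℝ} (hu : Summable u) : ∃ K, ∀ x, |u x| ≤ K :=
  ⟨∑' x, |u x|, fun x => hu.abs.le_tsum x fun _ _ => abs_nonneg _⟩

lemma summable_eval_mul_geometric (p : ℝ[X]) {q : ℝ} (hq : |q| < 1) :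
    Summable fun x : ℕ => p.eval (x : ℝ) * q ^ x := by
  induction p using Polynomial.induction_on' with
  | add p₁ p₂ h₁ h₂ => simpa [add_mul] using h₁.add h₂
  | monomial n b =>
    have := (summable_pow_mul_geometric_of_norm_lt_one (R := ℝ) n (by simpa using hq)).mul_left b
    simpa [mul_assoc] using this

namespace ExpDecay

variable {t u : ℕ → ℝ}

lemma mono (ht : ExpDecay t) {K : ℝ} (h : ∀ x, |u x| ≤ K * |t x|) : ExpDecay u := by
  obtain ⟨A, r, hr0, hr1, hA⟩ := ht
  refine ⟨|K| * A, r, hr0, hr1, fun x => (h x).trans ?_⟩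
  calc K * |t x| ≤ |K| * |t x| := by gcongr; exact le_abs_self K
    _ ≤ |K| * (A * r ^ x) := by gcongr; exact hA x
    _ = _ := by ring

lemma sqrt (ht : ExpDecay t) : ExpDecay fun x => Real.sqrt (t x) := by
  obtain ⟨A, r, hr0, hr1, hA⟩ := ht
  refine ⟨Real.sqrt A, Real.sqrt r, Real.sqrt_pos.2 hr0, (Real.sqrt_lt' one_pos).2 (by simpa),
    fun x => ?_⟩
  have hA0 : 0 ≤ A := by simpa using (abs_nonneg _).trans (hA 0)
  rw [abs_of_nonneg (Real.sqrt_nonneg _)]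
  refine Real.sqrt_le_iff.2 ⟨by positivity, ((le_abs_self _).trans (hA x)).trans_eq ?_⟩
  rw [mul_pow, Real.sq_sqrt hA0, pow_right_comm, Real.sq_sqrt hr0.le]

lemma eval_mul (ht : ExpDecay t) (p : ℝ[X]) : ExpDecay fun x => p.eval (x : ℝ) * t x := by
  obtain ⟨A, r, hr0, hr1, hA⟩ := ht
  -- Room between r and 1 absorbs the polynomial: p(x)(r/s)^x is bounded.
  obtain ⟨s, hrs, hs1⟩ := exists_between hr1
  have hs0 : 0 < s := hr0.trans hrs
  obtain ⟨K, hK⟩ := Summable.exists_abs_le (summable_eval_mul_geometric p (q := r / s)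
    (by rw [abs_of_pos (by positivity)]; exact (div_lt_one hs0).2 hrs))
  have hA0 : 0 ≤ A := by simpa using (abs_nonneg _).trans (hA 0)
  refine ⟨K * A, s, hs0, hs1, fun x => ?_⟩
  rw [abs_mul]
  have h1 : |p.eval (x : ℝ)| * r ^ x ≤ K * s ^ x := by
    have := hK x
    rw [abs_mul, div_pow, abs_of_pos (by positivity : 0 < r ^ x / s ^ x), ← mul_div_assoc,
      div_le_iff₀ (by positivity)] at this
    exact this
  calc |p.eval (x : ℝ)| * |t x| ≤ |p.eval (x : ℝ)| * (A * r ^ x) := by gcongr; exact hA x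
    _ = |p.eval (x : ℝ)| * r ^ x * A := by ring
    _ ≤ K * s ^ x * A := by gcongr
    _ = _ := by ring

lemma summable (ht : ExpDecay t) : Summable t := by
  obtain ⟨A, r, hr0, hr1, hA⟩ := ht
  exact Summable.of_norm_bounded ((summable_geometric_of_lt_one hr0.le hr1).mul_left A)
    (by simpa using hA)

lemma summable_eval_mul (ht : ExpDecay t) (p : ℝ[X]) :
    Summable fun x : ℕ => p.eval (x : ℝ) * t x := (ht.eval_mul p).summable

end ExpDecay

/-- The moment functional `p ↦ ∑ₓ p(x) t(x)` of an exponentially decaying sequence. -/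
def momentFunctional (t : ℕ → ℝ) (ht : ExpDecay t) : ℝ[X] →ₗ[ℝ] ℝ where
  toFun p := ∑' x : ℕ, p.eval (x : ℝ) * t x
  map_add' p q := by
    simp only [eval_add, add_mul]
    exact (ht.summable_eval_mul p).tsum_add (ht.summable_eval_mul q)
  map_smul' b p := by simp [mul_assoc, tsum_mul_left]

lemma momentFunctional_apply {t : ℕ → ℝ} (ht : ExpDecay t) (p : ℝ[X]) :
    momentFunctional t ht p = ∑' x : ℕ, p.eval (x : ℝ) * t x := rfl

/-- An exponentially decaying sequence is determined by its moments. -/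
lemma ExpDecay.eq_zero_of_moments {t : ℕ → ℝ} (ht : ExpDecay t)
    (h : ∀ j : ℕ, ∑' x : ℕ, (x : ℝ) ^ j * t x = 0) (x : ℕ) : t x = 0 := by
  obtain ⟨A, r, hr0, hr1, hA⟩ := ht
  have hA0 : 0 ≤ A := by simpa using (abs_nonneg _).trans (hA 0)
  have hsum : ∀ s : ℝ, |s| < 1 / r → Summable fun x => |t x| * |s| ^ x := by
    intro s hs
    have h1 : r * |s| < 1 := by rwa [lt_div_iff₀ hr0, mul_comm] at hs
    refine Summable.of_nonneg_of_le (fun x => by positivity) (fun x => ?_)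
      ((summable_geometric_of_lt_one (by positivity) h1).mul_left A)
    rw [mul_pow, ← mul_assoc]
    gcongr
    exact hA x
  -- The generating function ∑ t_x s^x. Its radius is at least 1/r > 1, so s = 1 is an interior
  -- point.
  set p := FormalMultilinearSeries.ofScalars ℝ t with hp
  have hrad : ENNReal.ofReal (1 / r) ≤ p.radius := by
    refine ENNReal.le_of_forall_nnreal_lt fun s hs => p.le_radius_of_summable_norm ?_
    have hs' : |(s : ℝ)| < 1 / r := by
      rw [abs_of_nonneg s.coe_nonneg]
      have := (ENNReal.toReal_lt_toReal (by simp) (by simp)).2 hs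
      rwa [ENNReal.coe_toReal, ENNReal.toReal_ofReal (by positivity)] at this
    have := hsum s hs'
    rw [abs_of_nonneg s.coe_nonneg] at this
    refine this.congr fun n => ?_
    rw [hp, FormalMultilinearSeries.ofScalars_norm, Real.norm_eq_abs]
  have hpos : 0 < ENNReal.ofReal (1 / r) := by simpa using hr0
  have hball : HasFPowerSeriesOnBall p.sum p 0 (ENNReal.ofReal (1 / r)) :=
    (p.hasFPowerSeriesOnBall (hpos.trans_le hrad)).mono hpos hrad
  have hfun : ∀ s : ℝ, p.sum s = ∑' x : ℕ, t x * s ^ x := by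
    intro s
    rw [hp, FormalMultilinearSeries.sum]
    exact tsum_congr fun n => by simp [mul_comm]
  -- With s = e^y, expanding e^{xy} in powers of y turns the generating function into a series in
  -- the moments. The bound on exp |y| makes the double series absolutely convergent.
  have hexp : ∀ y : ℝ, Real.exp |y| < 1 / r → p.sum (Real.exp y) = 0 := by
    intro y hy
    rw [hfun]
    have hS : Summable fun q : ℕ × ℕ => t q.1 * ((q.1 * y) ^ q.2 / q.2.factorial) := by
      refine Summable.of_norm ?_
      rw [summable_prod_of_nonneg (fun _ => norm_nonneg _)]
      have hE : ∀ x : ℕ, HasSum (fun j : ℕ => ‖t x * ((x * y) ^ j / j.factorial)‖)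
          (|t x| * |Real.exp (|y|)| ^ x) := by
        intro x
        have := (NormedSpace.expSeries_div_hasSum_exp (x * |y|)).mul_left |t x|
        rw [← Real.exp_eq_exp_ℝ, Real.exp_nat_mul] at this
        rw [abs_of_pos (Real.exp_pos _)]
        refine this.congr_fun fun j => ?_
        rw [norm_mul, norm_div, norm_pow, norm_mul]
        simp
      refine ⟨fun x => (hE x).summable, ?_⟩
      simp only [fun x => (hE x).tsum_eq]
      exact hsum _ (by rwa [abs_of_pos (Real.exp_pos _)])
    have e1 : ∀ x : ℕ, t x * Real.exp y ^ x = ∑' j : ℕ, t x * ((x * y) ^ j / j.factorial) := by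
      intro x
      rw [tsum_mul_left, ← Real.exp_nat_mul, Real.exp_eq_exp_ℝ,
        (NormedSpace.expSeries_div_hasSum_exp ((x : ℝ) * y)).tsum_eq]
    simp only [e1]
    have hS' : Summable (Function.uncurry fun x j : ℕ => t x * ((x * y) ^ j / j.factorial)) := hS
    rw [← hS'.tsum_comm]
    refine (tsum_congr fun j => ?_).trans tsum_zero
    have : ∀ x : ℕ, t x * ((x * y) ^ j / j.factorial) =
        (y ^ j / j.factorial) * ((x : ℝ) ^ j * t x) := fun x => by rw [mul_pow]; ring
    simp only [this]
    rw [tsum_mul_left, h j, mul_zero]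
  have hr1' : 1 < 1 / r := (one_lt_div hr0).2 hr1
  have hev : p.sum =ᶠ[nhds 1] 0 := by
    have hcont : ContinuousAt (fun s => Real.exp |Real.log s|) 1 :=
      Real.continuous_exp.continuousAt.comp
        (continuous_abs.continuousAt.comp (Real.continuousAt_log one_ne_zero))
    have h1 : ∀ᶠ s in nhds (1 : ℝ), Real.exp |Real.log s| < 1 / r :=
      hcont.eventually_lt continuousAt_const (by simpa using hr1')
    filter_upwards [h1, lt_mem_nhds (one_pos : (0 : ℝ) < 1)] with s hs hs0
    have := hexp _ hs
    rwa [Real.exp_log hs0] at this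
  -- Vanishing near 1 spreads to the whole interval of convergence by the identity theorem, hence to
  -- a neighbourhood of 0, where the coefficients are read off.
  have hzero : Set.EqOn p.sum 0 (Metric.eball 0 (ENNReal.ofReal (1 / r))) := by
    refine hball.analyticOnNhd.eqOn_zero_of_preconnected_of_eventuallyEq_zero ?_
      (z₀ := (1 : ℝ)) ?_ hev
    · rw [Metric.eball_ofReal]
      exact (convex_ball _ _).isPreconnected
    · rw [Metric.eball_ofReal]
      simpa using hr1'
  have hp0 : p = 0 := hball.hasFPowerSeriesAt.eq_zero_of_eventually
    (Filter.eventually_of_mem (Metric.eball_mem_nhds _ hpos) hzero)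
  have hx : p.coeff x = 0 := by rw [hp0]; rfl
  rwa [hp, FormalMultilinearSeries.coeff_ofScalars] at hx

/-! ### Christoffel's formula -/

section Christoffel

variable {k : ℕ} (P : ℕ → ℝ[X]) (z : Fin k → ℝ)

/-- The Casorati determinant of the sequences `n ↦ P n (z i)`. -/
def casorati (n : ℕ) : ℝ :=
  Matrix.det (Matrix.of fun i j : Fin k => (P (n + j)).eval (z i))

/-- Christoffel's determinant, which vanishes at the points `z i`. -/
def christoffel (n : ℕ) : ℝ[X] :=
  Matrix.det (Matrix.of fun i j : Fin (k + 1) =>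
    (Fin.cons (P (n + j)) (fun i => C ((P (n + j)).eval (z i))) : Fin (k + 1) → ℝ[X]) i)

/-- The coefficients of Christoffel's determinant in terms of the polynomials `P`. -/
def christoffelCoeff (n : ℕ) (j : Fin (k + 1)) : ℝ :=
  (-1) ^ (j : ℕ) * Matrix.det (Matrix.of fun i j' : Fin k =>
    (P (n + (j.succAbove j' : ℕ))).eval (z i))

/-- Only the two extreme coefficients matter: this one governs the pairing with `P n`, and
`christoffelCoeff_last` the leading coefficient. -/
lemma christoffelCoeff_zero (n : ℕ) : christoffelCoeff P z n 0 = casorati P z (n + 1) := by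
  simp only [christoffelCoeff, casorati, Fin.val_zero, pow_zero, one_mul, Fin.zero_succAbove,
    Fin.val_succ]
  congr 2
  ext i j
  rw [show n + ((j : ℕ) + 1) = n + 1 + j by ring]

lemma christoffelCoeff_last (n : ℕ) :
    christoffelCoeff P z n (Fin.last k) = (-1) ^ k * casorati P z n := by
  simp [christoffelCoeff, casorati]

lemma christoffel_eq_sum (n : ℕ) :
    christoffel P z n = ∑ j : Fin (k + 1), C (christoffelCoeff P z n j) * P (n + j) := by
  rw [christoffel, Matrix.det_succ_row_zero]
  refine Finset.sum_congr rfl fun j _ => ?_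
  have : (Matrix.submatrix (Matrix.of fun i j : Fin (k + 1) => (Fin.cons (P (n + j))
      (fun i => C ((P (n + j)).eval (z i))) : Fin (k + 1) → ℝ[X]) i) Fin.succ j.succAbove) =
      C.mapMatrix (Matrix.of fun i j' : Fin k => (P (n + (j.succAbove j' : ℕ))).eval (z i)) := by
    ext i j'
    simp
  rw [this, ← RingHom.map_det, christoffelCoeff, C_mul, C_pow, C_neg, C_1]
  simp only [Matrix.of_apply, Fin.cons_zero]
  ring

lemma eval_christoffel (n : ℕ) (x : ℝ) :
    (christoffel P z n).eval x = Matrix.det (Matrix.of fun i j : Fin (k + 1) =>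
      (P (n + j)).eval ((Fin.cons x z : Fin (k + 1) → ℝ) i)) := by
  rw [christoffel, ← coe_evalRingHom, RingHom.map_det]
  congr 1
  ext i j
  refine Fin.cases ?_ (fun i => ?_) i <;> simp

lemma eval_christoffel_node (n : ℕ) (i : Fin k) : (christoffel P z n).eval (z i) = 0 := by
  rw [eval_christoffel]
  exact Matrix.det_zero_of_row_eq (Fin.succ_ne_zero i).symm (by ext; simp)

variable {P z} (hz : Function.Injective z)

include hz in
lemma prod_X_sub_C_dvd {p : ℝ[X]} (h : ∀ i, p.eval (z i) = 0) : ∏ i, (X - C (z i)) ∣ p :=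
  Fintype.prod_dvd_of_coprime (pairwise_coprime_X_sub_C hz) fun i => dvd_iff_isRoot.2 (h i)

lemma monic_nodes : (∏ i, (X - C (z i))).Monic := monic_prod_of_monic _ _ fun _ _ => monic_X_sub_C _

lemma natDegree_nodes : (∏ i, (X - C (z i))).natDegree = k := by
  rw [natDegree_prod_of_monic _ _ fun _ _ => monic_X_sub_C _]; simp

variable (hdeg : ∀ n, (P n).degree = n)

section degree

include hdeg

lemma natDegree_of_degree (n : ℕ) : (P n).natDegree = n := natDegree_eq_of_degree_eq_some (hdeg n)

lemma leadingCoeff_ne_zero_of_degree (n : ℕ) : (P n).leadingCoeff ≠ 0 :=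
  leadingCoeff_ne_zero.2 fun h => by simpa [h] using hdeg n

lemma natDegree_christoffel_le (n : ℕ) : (christoffel P z n).natDegree ≤ n + k := by
  rw [christoffel_eq_sum]
  refine natDegree_sum_le_of_forall_le _ _ fun j _ => (natDegree_C_mul_le _ _).trans ?_
  rw [natDegree_of_degree hdeg]
  have := j.2
  omega

lemma coeff_christoffel (n : ℕ) :
    (christoffel P z n).coeff (n + k) = (-1) ^ k * casorati P z n * (P (n + k)).leadingCoeff := by
  rw [christoffel_eq_sum, finsetSum_coeff, Fin.sum_univ_castSucc, Finset.sum_eq_zero, zero_add]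
  · rw [coeff_C_mul, christoffelCoeff_last, Fin.val_last, leadingCoeff, natDegree_of_degree hdeg]
  · intro j _
    rw [coeff_C_mul, coeff_eq_zero_of_natDegree_lt, mul_zero]
    rw [natDegree_of_degree hdeg]
    have := j.2
    simp

end degree

variable {L : ℝ[X] →ₗ[ℝ] ℝ} (hL : ∀ (n : ℕ) (p : ℝ[X]), p.degree < n → L (P n * p) = 0)

section orthogonality

include hL

/-- The determinant combines only P_n, ..., P_{n+k}, each orthogonal to all polynomials of degree
below n. -/
lemma functional_christoffel_mul (n : ℕ) {p : ℝ[X]} (hp : p.degree < n) :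
    L (christoffel P z n * p) = 0 := by
  rw [christoffel_eq_sum, Finset.sum_mul, map_sum]
  refine Finset.sum_eq_zero fun j _ => ?_
  rw [mul_assoc, ← smul_eq_C_mul, map_smul, hL, smul_zero]
  exact hp.trans_le (by exact_mod_cast Nat.le_add_right n j)

include hdeg in
lemma functional_christoffel_mul_self (n : ℕ) :
    L (christoffel P z n * P n) = casorati P z (n + 1) * L (P n * P n) := by
  rw [christoffel_eq_sum, Finset.sum_mul, map_sum, Fin.sum_univ_succ, Finset.sum_eq_zero, add_zero]
  · rw [mul_assoc, ← smul_eq_C_mul, map_smul, christoffelCoeff_zero]; simp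
  · intro j _
    rw [mul_assoc, ← smul_eq_C_mul, map_smul, hL, smul_zero]
    rw [hdeg]
    exact_mod_cast (by simp : n < n + (j.succ : ℕ))

variable (hpos : ∀ r : ℝ[X], r ≠ 0 → 0 < L ((∏ i, (X - C (z i))) * r * r))

include hz hdeg hpos

/-- A singular matrix yields a nonzero combination R of P_n, ..., P_{n+k-1} vanishing at all nodes,
so R = ∏(X - z_i) r with deg r < n. Orthogonality gives L(R r) = 0, against positivity of the
transformed functional. `L` itself need not be positive, which matters for negative c. -/
lemma casorati_ne_zero (n : ℕ) : casorati P z n ≠ 0 := by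
  intro h0
  obtain ⟨v, hv, hv0⟩ := Matrix.exists_mulVec_eq_zero_iff.2 h0
  set R : ℝ[X] := ∑ j : Fin k, C (v j) * P (n + j) with hR
  have hRz : ∀ i, R.eval (z i) = 0 := by
    intro i
    have := congrFun hv0 i
    simp only [Matrix.mulVec, dotProduct, Matrix.of_apply, Pi.zero_apply] at this
    rw [hR, eval_finsetSum, ← this]
    exact Finset.sum_congr rfl fun j _ => by simp [mul_comm]
  have hR0 : R ≠ 0 := by
    intro hR0
    let S : Polynomial.Sequence ℝ := ⟨P, hdeg⟩
    have hli : LinearIndependent ℝ fun j : Fin k => P (n + j) :=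
      S.linearIndependent.comp (fun j : Fin k => n + (j : ℕ))
        fun i j hij => Fin.ext (Nat.add_left_cancel hij)
    refine hv (funext fun j => Fintype.linearIndependent_iff.1 hli v ?_ j)
    simpa only [smul_eq_C_mul] using hR0
  obtain ⟨r, hr⟩ := prod_X_sub_C_dvd hz hRz
  have hr0 : r ≠ 0 := by rintro rfl; simp [hr] at hR0
  have hdr : r.natDegree < n := by
    have h1 : R.natDegree = k + r.natDegree := by
      rw [hr, monic_nodes.natDegree_mul' hr0, natDegree_nodes]
    have h2 : R.degree < (n + k : ℕ) := by
      refine (degree_sum_le _ _).trans_lt ((Finset.sup_lt_iff (WithBot.bot_lt_coe _)).2 fun j _ => ?_)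
      rw [← smul_eq_C_mul]
      refine (degree_smul_le _ _).trans_lt ?_
      rw [hdeg]
      exact_mod_cast Nat.add_lt_add_left j.2 n
    have h3 := (natDegree_lt_iff_degree_lt hR0).2 h2
    omega
  have := hpos r hr0
  rw [← hr, hR, Finset.sum_mul, map_sum, Finset.sum_eq_zero] at this
  · exact lt_irrefl _ this
  · intro j _
    rw [mul_assoc, ← smul_eq_C_mul, map_smul, hL, smul_zero]
    refine (natDegree_lt_iff_degree_lt hr0).1 (hdr.trans_le (Nat.le_add_right _ _))

/-- Christoffel's formula for the orthogonal polynomials of the transformed functional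
`p ↦ L (∏ i, (X - z i) * p)`. -/
theorem exists_christoffel_transform : ∃ q : ℕ → ℝ[X],
    (∀ n, christoffel P z n = (∏ i, (X - C (z i))) * q n) ∧ (∀ n, (q n).degree = n) ∧
    (∀ n m, n ≠ m → L ((∏ i, (X - C (z i))) * q n * q m) = 0) ∧
    ∀ n, L ((∏ i, (X - C (z i))) * q n * q n) =
      (-1) ^ k * casorati P z n * casorati P z (n + 1) *
        ((P (n + k)).leadingCoeff / (P n).leadingCoeff) * L (P n * P n) := by
  choose q hq using fun n => prod_X_sub_C_dvd hz (eval_christoffel_node P z n)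
  have hcoeff : ∀ n, (christoffel P z n).coeff (n + k) ≠ 0 := fun n => by
    rw [coeff_christoffel hdeg]
    exact mul_ne_zero (mul_ne_zero (by simp) (casorati_ne_zero hz hdeg hL hpos n))
      (leadingCoeff_ne_zero_of_degree hdeg _)
  have hnat : ∀ n, (christoffel P z n).natDegree = n + k := fun n =>
    natDegree_eq_of_le_of_coeff_ne_zero (natDegree_christoffel_le hdeg n) (hcoeff n)
  have hq0 : ∀ n, q n ≠ 0 := fun n h => hcoeff n (by rw [hq, h]; simp)
  have hqnat : ∀ n, (q n).natDegree = n := fun n => by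
    have := hnat n
    rw [hq, monic_nodes.natDegree_mul' (hq0 n), natDegree_nodes] at this
    omega
  have hqdeg : ∀ n, (q n).degree = n := fun n => by
    rw [degree_eq_natDegree (hq0 n), hqnat]
  have hlead : ∀ n, (q n).leadingCoeff =
      (-1) ^ k * casorati P z n * (P (n + k)).leadingCoeff := fun n => by
    rw [← coeff_christoffel hdeg, ← hnat, coeff_natDegree, hq, leadingCoeff_monic_mul monic_nodes]
  have hlt : ∀ n m, m < n → L ((∏ i, (X - C (z i))) * q n * q m) = 0 := fun n m hmn => by
    rw [← hq, functional_christoffel_mul hL]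
    rw [hqdeg]
    exact_mod_cast hmn
  refine ⟨q, hq, hqdeg, fun n m hnm => ?_, fun n => ?_⟩
  · rcases lt_or_gt_of_ne hnm with h | h
    · rw [mul_assoc, mul_comm (q n), ← mul_assoc]
      exact hlt _ _ h
    · exact hlt _ _ h
  · have hl := leadingCoeff_ne_zero_of_degree hdeg n
    -- Matching leading coefficients: q_n - b P_n has degree below n, so in the pairing with
    -- Christoffel's determinant q_n may be replaced by b P_n.
    set b := (q n).leadingCoeff / (P n).leadingCoeff with hb
    have hb0 : b ≠ 0 := div_ne_zero (leadingCoeff_ne_zero.2 (hq0 n)) hl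
    have hs : (q n - C b * P n).degree < n := by
      have := degree_sub_lt_left (p := q n) (q := C b * P n)
        (by rw [degree_C_mul hb0, hdeg, hqdeg]) (hq0 n)
        (by rw [leadingCoeff_C_mul_of_isUnit hb0.isUnit, hb, div_mul_cancel₀ _ hl])
      rwa [hqdeg] at this
    rw [← hq, show christoffel P z n * q n =
      christoffel P z n * (q n - C b * P n) + C b * (christoffel P z n * P n) by ring, map_add,
      functional_christoffel_mul hL n hs, ← smul_eq_C_mul, map_smul,
      functional_christoffel_mul_self hdeg hL, hb, hlead, smul_eq_mul]
    ring

end orthogonality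

end Christoffel

/-! ### Orthogonality of the Meixner polynomials -/

/-- The masses of the (possibly signed) Meixner measure. -/
def meixnerWeight (a c : ℝ) (x : ℕ) : ℝ := a ^ x * Real.Gamma (x + c) / x.factorial

lemma hasSum_poch {a : ℝ} (ha₀ : 0 < a) (ha₁ : a < 1) (c : ℝ) :
    HasSum (fun x : ℕ => a ^ x * poch c x / x.factorial) ((1 - a) ^ (-c)) := by
  have h := (Real.one_div_one_sub_rpow_hasFPowerSeriesOnBall_zero c).hasSum (y := a)
    (by rw [← ENNReal.ofReal_one, Metric.eball_ofReal]; simpa [abs_of_pos ha₀] using ha₁)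
  rw [zero_add, one_div, ← Real.rpow_neg (by linarith)] at h
  refine h.congr_fun fun n => ?_
  rw [FormalMultilinearSeries.ofScalars_apply_eq, ← Ring.multichoose_eq, multichoose_eq_poch,
    smul_eq_mul]
  ring

section

variable {a c : ℝ} (ha₀ : 0 < a) (ha₁ : a < 1) (hc : ∀ j : ℕ, c ≠ -(j : ℝ))

include ha₀ ha₁ in
-- For a < s < 1 the terms of the convergent series at s are bounded, so those at a are O((a/s)^x).
lemma expDecay_poch (c : ℝ) : ExpDecay fun x : ℕ => a ^ x * poch c x / x.factorial := by
  obtain ⟨s, has, hs1⟩ := exists_between ha₁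
  have hs0 : 0 < s := ha₀.trans has
  obtain ⟨K, hK⟩ := Summable.exists_abs_le (hasSum_poch hs0 hs1 c).summable
  refine ⟨K, a / s, by positivity, (div_lt_one hs0).2 has, fun x => ?_⟩
  have e : a ^ x * poch c x / x.factorial = s ^ x * poch c x / x.factorial * (a / s) ^ x := by
    rw [div_pow]; field_simp
  simp only [e]
  rw [abs_mul, abs_of_pos (by positivity : 0 < (a / s) ^ x)]
  gcongr
  exact hK x

include hc in
lemma meixnerWeight_eq (x : ℕ) :
    meixnerWeight a c x = Real.Gamma c * (a ^ x * poch c x / x.factorial) := by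
  rw [meixnerWeight, add_comm (x : ℝ), Gamma_add_nat hc]; ring

include ha₀ ha₁ hc in
lemma expDecay_meixnerWeight : ExpDecay (meixnerWeight a c) :=
  (expDecay_poch ha₀ ha₁ c).mono (K := |Real.Gamma c|) fun x => by
    rw [meixnerWeight_eq hc, abs_mul]

include ha₀ ha₁ hc in
-- The falling factorial kills x < i; after x = y + i the factorials and Pochhammer symbols merge
-- into the binomial series with parameter c + i + j.
lemma hasSum_descPochhammer_mul_poch (i j : ℕ) :
    HasSum (fun x : ℕ => (descPochhammer ℝ i).eval (x : ℝ) * poch (x + c) j * meixnerWeight a c x)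
      (a ^ i * Real.Gamma c * poch c (i + j) * (1 - a) ^ (-(c + (i + j : ℕ)))) := by
  have hinj : Function.Injective fun y : ℕ => y + i := add_left_injective i
  rw [← hinj.hasSum_iff]
  · refine ((hasSum_poch ha₀ ha₁ (c + (i + j : ℕ))).mul_left
      (a ^ i * Real.Gamma c * poch c (i + j))).congr_fun fun y => ?_
    simp only [Function.comp_apply]
    rw [meixnerWeight_eq hc, descPochhammer_eval_eq_descFactorial,
      show ((y + i : ℕ) : ℝ) + c = c + (y + i : ℕ) by ring]
    have h1 : (y.factorial : ℝ) * ((y + i).descFactorial i : ℝ) = (y + i).factorial := by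
      have := Nat.factorial_mul_descFactorial (Nat.le_add_left i y)
      rw [Nat.add_sub_cancel] at this
      exact_mod_cast this
    have h2 : poch c (y + i) * poch (c + (y + i : ℕ)) j =
        poch c (i + j) * poch (c + (i + j : ℕ)) y := by
      rw [← poch_add, ← poch_add]; congr 1; ring
    have h3 : ((y + i).descFactorial i : ℝ) = (y + i).factorial / y.factorial := by
      rw [eq_div_iff (by positivity), mul_comm, h1]
    have h4 : ((y + i).factorial : ℝ) ≠ 0 := by positivity
    rw [h3, pow_add]
    field_simp
    linear_combination (Real.Gamma c) * h2
  · intro x hx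
    have : x < i := by
      by_contra h
      exact hx ⟨x - i, by simp; omega⟩
    rw [descPochhammer_eval_eq_descFactorial, Nat.descFactorial_eq_zero_iff_lt.2 this]
    simp

/-- Up to the sign (-1)^n this is the n-th forward difference, at c, of a monic polynomial of degree
j. -/
lemma alternating_sum_poch (c : ℝ) (n j : ℕ) (hj : j ≤ n) :
    ∑ i ∈ Finset.range (n + 1), (n.choose i : ℝ) * (-1) ^ i * poch (c + i) j =
      if j = n then (-1) ^ n * (n.factorial : ℝ) else 0 := by
  have h := fwdDiff_iter_eq_sum_shift (1 : ℝ) (fun x => (ascPochhammer ℝ j).eval x) n c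
  have e : ∑ i ∈ Finset.range (n + 1), (n.choose i : ℝ) * (-1) ^ i * poch (c + i) j =
      (-1) ^ n * (fwdDiff (1 : ℝ))^[n] (fun x => (ascPochhammer ℝ j).eval x) c := by
    rw [h, Finset.mul_sum]
    refine Finset.sum_congr rfl fun i hi => ?_
    obtain ⟨m, rfl⟩ := Nat.exists_eq_add_of_le (show i ≤ n by simpa [Nat.lt_succ_iff] using hi)
    have hm : ((-1 : ℝ)) ^ m * (-1) ^ m = 1 := by
      rw [← pow_add]; exact Even.neg_one_pow ⟨m, rfl⟩
    simp only [Nat.add_sub_cancel_left, zsmul_eq_mul, nsmul_eq_mul, mul_one, poch]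
    push_cast
    rw [pow_add]
    linear_combination (-((i + m).choose i : ℝ) * (-1) ^ i * (ascPochhammer ℝ j).eval (c + i)) * hm
  rw [e]
  split_ifs with hjn
  · subst hjn
    have h2 := congrFun (Polynomial.fwdDiff_iter_degree_eq_factorial (ascPochhammer ℝ j)) c
    rw [ascPochhammer_natDegree, (monic_ascPochhammer ℝ j).leadingCoeff] at h2
    rw [h2]
    simp
  · have h2 := congrFun (Polynomial.fwdDiff_iter_eq_zero_of_degree_lt (P := ascPochhammer ℝ j)
      (n := n) (by rw [ascPochhammer_natDegree]; omega)) c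
    rw [h2]
    simp

/-- The basis `(x + c)_j` of the space of polynomials. -/
def risingSeq (c : ℝ) : Polynomial.Sequence ℝ where
  elems' j := (ascPochhammer ℝ j).comp (X + C c)
  degree_eq' j := by
    have hm : ((ascPochhammer ℝ j).comp (X + C c)).Monic := (monic_ascPochhammer ℝ j).comp_X_add_C c
    rw [degree_eq_natDegree hm.ne_zero, natDegree_comp, ascPochhammer_natDegree,
      natDegree_X_add_C, mul_one]

lemma risingSeq_apply (c : ℝ) (j : ℕ) : risingSeq c j = (ascPochhammer ℝ j).comp (X + C c) := rfl

lemma monic_risingSeq (c : ℝ) (j : ℕ) : (risingSeq c j).Monic :=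
  (monic_ascPochhammer ℝ j).comp_X_add_C c

include hc in
-- Falling factorials in `hypMeixner` against rising ones in the test polynomial give closed
-- moments; the powers of a and 1 - a then collapse and `alternating_sum_poch` remains.
lemma functional_hypMeixner_mul_risingSeq (n j : ℕ) (hj : j ≤ n) :
    momentFunctional _ (expDecay_meixnerWeight ha₀ ha₁ hc) (hypMeixner a c n * risingSeq c j) =
      if j = n then Real.Gamma c * (1 - a) ^ (-(c + n)) * ((-1) ^ n * n.factorial) else 0 := by
  have h1a : 0 < 1 - a := by linarith
  have hS : HasSum (fun x : ℕ => (hypMeixner a c n * risingSeq c j).eval (x : ℝ) *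
      meixnerWeight a c x) (∑ i ∈ Finset.range (n + 1),
      (n.choose i : ℝ) * (1 - 1 / a) ^ i / poch c i *
        (a ^ i * Real.Gamma c * poch c (i + j) * (1 - a) ^ (-(c + (i + j : ℕ))))) := by
    refine (hasSum_sum fun i _ => (hasSum_descPochhammer_mul_poch ha₀ ha₁ hc i j).mul_left
      ((n.choose i : ℝ) * (1 - 1 / a) ^ i / poch c i)).congr_fun fun x => ?_
    rw [eval_mul, eval_hypMeixner, Finset.sum_mul, Finset.sum_mul]
    refine Finset.sum_congr rfl fun i _ => ?_
    rw [risingSeq_apply, eval_comp, eval_add, eval_X, eval_C, ← poch]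
    ring
  rw [momentFunctional_apply, hS.tsum_eq]
  have : ∀ i ∈ Finset.range (n + 1), (n.choose i : ℝ) * (1 - 1 / a) ^ i / poch c i *
      (a ^ i * Real.Gamma c * poch c (i + j) * (1 - a) ^ (-(c + (i + j : ℕ)))) =
      Real.Gamma c * (1 - a) ^ (-(c + j)) * ((n.choose i : ℝ) * (-1) ^ i * poch (c + i) j) := by
    intro i _
    have hp := poch_ne_zero hc i
    have e1 : (1 - 1 / a) ^ i * a ^ i = (-1) ^ i * (1 - a) ^ i := by
      rw [← mul_pow, ← mul_pow]; congr 1; field_simp; ring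
    have e2 : (1 - a) ^ (-(c + (i + j : ℕ))) * (1 - a) ^ i = (1 - a) ^ (-(c + j)) := by
      rw [← Real.rpow_natCast, ← Real.rpow_add h1a]; congr 1; push_cast; ring
    rw [poch_add, ← e2]
    generalize 1 - 1 / a = B at e1 ⊢
    field_simp
    linear_combination (Real.Gamma c * (n.choose i : ℝ) * poch (c + i) j) * e1
  rw [Finset.sum_congr rfl this, ← Finset.mul_sum, alternating_sum_poch c n j hj]
  split_ifs with h
  · rw [h]
  · simp

lemma coeff_hypMeixner_self (n : ℕ) :
    (hypMeixner a c n).coeff n = (1 - 1 / a) ^ n / poch c n := by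
  rw [hypMeixner, finsetSum_coeff, Finset.sum_range_succ, Finset.sum_eq_zero, zero_add]
  · have := (monic_descPochhammer ℝ n).coeff_natDegree
    rw [descPochhammer_natDegree] at this
    rw [coeff_C_mul, this]
    simp
  · intro i hi
    rw [coeff_C_mul, coeff_eq_zero_of_natDegree_lt, mul_zero]
    rw [descPochhammer_natDegree]
    exact Finset.mem_range.1 hi

include ha₀ ha₁ hc in
lemma degree_hypMeixner (n : ℕ) : (hypMeixner a c n).degree = n := by
  refine degree_eq_of_le_of_coeff_ne_zero ?_ ?_
  · refine natDegree_le_iff_degree_le.1 (natDegree_sum_le_of_forall_le _ _ fun i hi =>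
      (natDegree_C_mul_le _ _).trans ?_)
    rw [descPochhammer_natDegree]
    simpa [Nat.lt_succ_iff] using hi
  · rw [coeff_hypMeixner_self]
    refine div_ne_zero (pow_ne_zero _ ?_) (poch_ne_zero hc n)
    rw [sub_ne_zero, Ne, eq_div_iff ha₀.ne']
    linarith

include ha₀ ha₁ hc in
lemma leadingCoeff_hypMeixner (n : ℕ) :
    (hypMeixner a c n).leadingCoeff = (1 - 1 / a) ^ n / poch c n := by
  rw [leadingCoeff, natDegree_eq_of_degree_eq_some (degree_hypMeixner ha₀ ha₁ hc n),
    coeff_hypMeixner_self]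

lemma functional_hypMeixner_mul (n : ℕ) (p : ℝ[X]) (hp : p.degree < n) :
    momentFunctional _ (expDecay_meixnerWeight ha₀ ha₁ hc) (hypMeixner a c n * p) = 0 := by
  have hmem : p ∈ Submodule.span ℝ (risingSeq c '' Set.Iio n) := by
    rw [Polynomial.Sequence.span_degreeLT _ fun i _ => by
      rw [(monic_risingSeq c i).leadingCoeff]; exact isUnit_one]
    exact mem_degreeLT.2 hp
  clear hp
  induction hmem using Submodule.span_induction with
  | mem q hq =>
    obtain ⟨j, hj, rfl⟩ := hq
    rw [functional_hypMeixner_mul_risingSeq ha₀ ha₁ hc n j (le_of_lt hj), if_neg (ne_of_lt hj)]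
  | zero => simp
  | add q₁ q₂ _ _ h₁ h₂ => rw [mul_add, map_add, h₁, h₂, add_zero]
  | smul b q _ h => rw [mul_smul_comm, map_smul, h, smul_zero]

/-- By orthogonality one factor may be replaced by its leading part l (x + c)_n. -/
lemma functional_hypMeixner_sq (n : ℕ) :
    momentFunctional _ (expDecay_meixnerWeight ha₀ ha₁ hc) (hypMeixner a c n * hypMeixner a c n) =
      n.factorial * Real.Gamma c * (1 - a) ^ (-c) / (a ^ n * poch c n) := by
  set l := (1 - 1 / a) ^ n / poch c n with hl
  have h1a : 0 < 1 - a := by linarith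
  have hd : (hypMeixner a c n - C l * risingSeq c n).degree < n := by
    have hl0 : l ≠ 0 := by
      rw [hl, ← leadingCoeff_hypMeixner ha₀ ha₁ hc]
      exact leadingCoeff_ne_zero_of_degree (degree_hypMeixner ha₀ ha₁ hc) n
    have := degree_sub_lt_left (p := hypMeixner a c n) (q := C l * risingSeq c n)
      (by rw [degree_C_mul hl0, degree_hypMeixner ha₀ ha₁ hc, Polynomial.Sequence.degree_eq])
      (leadingCoeff_ne_zero.1 (leadingCoeff_ne_zero_of_degree (degree_hypMeixner ha₀ ha₁ hc) n))
      (by rw [leadingCoeff_hypMeixner ha₀ ha₁ hc, leadingCoeff_C_mul_of_isUnit hl0.isUnit,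
        (monic_risingSeq c n).leadingCoeff, mul_one])
    rwa [degree_hypMeixner ha₀ ha₁ hc] at this
  have e : hypMeixner a c n * hypMeixner a c n =
      hypMeixner a c n * (hypMeixner a c n - C l * risingSeq c n) +
        C l * (hypMeixner a c n * risingSeq c n) := by ring
  rw [e, map_add, functional_hypMeixner_mul ha₀ ha₁ hc n _ hd, zero_add, ← smul_eq_C_mul, map_smul,
    functional_hypMeixner_mul_risingSeq ha₀ ha₁ hc n n le_rfl, if_pos rfl, smul_eq_mul, hl]
  have hp := poch_ne_zero hc n
  have e1 : (1 - 1 / a) ^ n * a ^ n * (-1) ^ n = (1 - a) ^ n := by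
    rw [← mul_pow, ← mul_pow]; congr 1; field_simp; ring
  have e2 : (1 - a) ^ (-(c + n)) * (1 - a) ^ n = (1 - a) ^ (-c) := by
    rw [← Real.rpow_natCast, ← Real.rpow_add h1a]; congr 1; ring
  rw [← e2]
  clear e hd hl
  generalize 1 - 1 / a = B at e1 ⊢
  field_simp
  linear_combination Real.Gamma c * e1

end

/-! ### Dual orthogonality and dual completeness -/

section Dual

variable {v : ℕ → ℝ} (hv : ExpDecay v) (hv0 : ∀ r, 0 ≤ v r) {q : ℕ → ℝ[X]}
  (hdeg : ∀ n, (q n).degree = n)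
  (horth : ∀ n m, n ≠ m → momentFunctional v hv (q n * q m) = 0)
  (hnorm : ∀ n, 0 < momentFunctional v hv (q n * q n))

/-- The orthonormal polynomials as functions on the support of the weight. -/
def dualFun (n : ℕ) (r : {r | 0 < v r}) : ℝ :=
  (q n).eval (r : ℝ) * Real.sqrt (v r) / Real.sqrt (momentFunctional v hv (q n * q n))

lemma hasSum_dualFun_mul (hv0 : ∀ r, 0 ≤ v r) (n m : ℕ) :
    HasSum (fun r : {r | 0 < v r} => dualFun (q := q) hv n r * dualFun (q := q) hv m r)
      (momentFunctional v hv (q n * q m) / (Real.sqrt (momentFunctional v hv (q n * q n)) *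
        Real.sqrt (momentFunctional v hv (q m * q m)))) := by
  have h : HasSum (fun r : ℕ => (q n * q m).eval (r : ℝ) * v r)
      (momentFunctional v hv (q n * q m)) := (hv.summable_eval_mul _).hasSum
  rw [← hasSum_subtype_iff_of_support_subset (s := {r | 0 < v r})] at h
  · refine (h.div_const _).congr_fun fun r => ?_
    have hr : Real.sqrt (v r) * Real.sqrt (v r) = v r := Real.mul_self_sqrt (hv0 r)
    simp only [dualFun, Function.comp_apply, eval_mul]
    linear_combination (((q n).eval (r : ℝ) * (q m).eval (r : ℝ) /
      (Real.sqrt (momentFunctional v hv (q n * q n)) *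
        Real.sqrt (momentFunctional v hv (q m * q m))))) * hr
  · intro r hr
    exact lt_of_le_of_ne (hv0 r) fun h0 => hr (by simp [← h0])

/-- The orthonormal polynomials as elements of `ℓ²`. -/
def dualVec (n : ℕ) : lp (fun _ : {r | 0 < v r} => ℝ) 2 :=
  ⟨dualFun (q := q) hv n, memℓp_gen (by
    have := (hasSum_dualFun_mul (q := q) hv hv0 n n).summable
    refine this.congr fun r => ?_
    simp [pow_two])⟩

include horth hnorm in
lemma orthonormal_dualVec : Orthonormal ℝ (dualVec (q := q) hv hv0) := by
  have hin : ∀ n m, inner ℝ (dualVec (q := q) hv hv0 n) (dualVec (q := q) hv hv0 m) =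
      momentFunctional v hv (q n * q m) / (Real.sqrt (momentFunctional v hv (q n * q n)) *
        Real.sqrt (momentFunctional v hv (q m * q m))) := by
    intro n m
    rw [lp.inner_eq_tsum, ← (hasSum_dualFun_mul (q := q) hv hv0 n m).tsum_eq]
    exact tsum_congr fun r => mul_comm _ _
  rw [orthonormal_iff_ite]
  intro n m
  rw [hin]
  split_ifs with h
  · subst h
    rw [Real.mul_self_sqrt (hnorm n).le, div_self (hnorm n).ne']
  · rw [horth n m h, zero_div]

include hdeg hnorm in
-- If f is orthogonal to every q_n, the sequence √v f, extended by zero off the support, has all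
-- moments zero. It decays exponentially because f is bounded, so it vanishes by
-- `ExpDecay.eq_zero_of_moments`.
lemma orthogonal_span_dualVec :
    (Submodule.span ℝ (Set.range (dualVec (q := q) hv hv0)))ᗮ = ⊥ := by
  classical
  rw [eq_bot_iff]
  intro f hf
  have hf0 : ∀ n, inner ℝ (dualVec (q := q) hv hv0 n) f = 0 := fun n =>
    (Submodule.mem_orthogonal _ _).1 hf _ (Submodule.subset_span ⟨n, rfl⟩)
  set t : ℕ → ℝ := fun r => if h : 0 < v r then Real.sqrt (v r) * f ⟨r, h⟩ else 0 with ht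
  have htd : ExpDecay t := hv.sqrt.mono (K := ‖f‖) fun r => by
    simp only [ht]
    split_ifs with h
    · rw [abs_mul, mul_comm]
      gcongr
      exact lp.norm_apply_le_norm two_ne_zero f _
    · simp only [abs_zero]; positivity
  have hq : ∀ n, momentFunctional t htd (q n) = 0 := by
    intro n
    have h1 := lp.hasSum_inner (𝕜 := ℝ) (dualVec (q := q) hv hv0 n) f
    rw [hf0 n] at h1
    have h2 : HasSum (fun r : ℕ => (q n).eval (r : ℝ) * t r) 0 := by
      rw [← hasSum_subtype_iff_of_support_subset (s := {r | 0 < v r})]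
      · have h3 := h1.mul_right (Real.sqrt (momentFunctional v hv (q n * q n)))
        rw [zero_mul] at h3
        refine h3.congr_fun fun r => ?_
        have hs : Real.sqrt (momentFunctional v hv (q n * q n)) ≠ 0 :=
          (Real.sqrt_pos.2 (hnorm n)).ne'
        have htr : t r = Real.sqrt (v r) * f r := dif_pos r.2
        change (q n).eval (r : ℝ) * t r = f r * dualFun (q := q) hv n r * _
        rw [htr, dualFun]
        field_simp
      · intro r hr
        by_contra h
        have htr : t r = 0 := dif_neg h
        exact hr (by simp only [htr, mul_zero])
    exact h2.tsum_eq
  have hall : ∀ p, momentFunctional t htd p = 0 := by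
    let S : Polynomial.Sequence ℝ := ⟨q, hdeg⟩
    have hspan := S.span fun i => (leadingCoeff_ne_zero_of_degree hdeg i).isUnit
    intro p
    have hp : p ∈ Submodule.span ℝ (Set.range S) := by rw [hspan]; trivial
    induction hp using Submodule.span_induction with
    | mem q' hq' => obtain ⟨n, rfl⟩ := hq'; exact hq n
    | zero => simp
    | add q₁ q₂ _ _ h₁ h₂ => rw [map_add, h₁, h₂, add_zero]
    | smul b q' _ h => rw [map_smul, h, smul_zero]
  have ht0 : ∀ r, t r = 0 := htd.eq_zero_of_moments fun j => by
    have := hall (X ^ j)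
    simpa [momentFunctional_apply] using this
  rw [Submodule.mem_bot]
  ext r
  have := ht0 r
  rw [show t r = Real.sqrt (v r) * f r from dif_pos r.2] at this
  simpa using (mul_eq_zero.1 this).resolve_left (Real.sqrt_pos.2 r.2).ne'

/-- The Hilbert basis of orthonormal polynomials. -/
def dualBasis : HilbertBasis ℕ ℝ (lp (fun _ : {r | 0 < v r} => ℝ) 2) :=
  HilbertBasis.mkOfOrthogonalEqBot (orthonormal_dualVec hv hv0 horth hnorm)
    (orthogonal_span_dualVec hv hv0 hdeg hnorm)

lemma inner_single_dualBasis (r : {r | 0 < v r}) (n : ℕ) :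
    inner ℝ (lp.single 2 r (1 : ℝ)) (dualBasis hv hv0 hdeg horth hnorm n) =
      dualFun (q := q) hv n r := by
  rw [lp.inner_single_left, dualBasis, HilbertBasis.coe_mkOfOrthogonalEqBot]
  simp [dualVec]

include hv0 hdeg horth hnorm

/-- Dual orthogonality. -/
theorem hasSum_dual (r s : ℕ) (hr : 0 < v r) (hs : 0 < v s) :
    HasSum (fun n => (q n).eval (r : ℝ) * (q n).eval (s : ℝ) / momentFunctional v hv (q n * q n))
      (if r = s then (v r)⁻¹ else 0) := by
  -- Parseval for the unit vectors at r and s, whose coordinates in the basis are the values of the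
  -- orthonormal functions there.
  have h := (dualBasis hv hv0 hdeg horth hnorm).hasSum_inner_mul_inner
    (lp.single 2 ⟨r, hr⟩ (1 : ℝ)) (lp.single 2 ⟨s, hs⟩ (1 : ℝ))
  have h' : ∀ n, inner ℝ (dualBasis hv hv0 hdeg horth hnorm n) (lp.single 2 ⟨s, hs⟩ (1 : ℝ)) =
      dualFun (q := q) hv n ⟨s, hs⟩ := fun n => by
    rw [real_inner_comm, inner_single_dualBasis]
  simp only [inner_single_dualBasis, h'] at h
  have h2 := h.div_const (Real.sqrt (v r) * Real.sqrt (v s))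
  have e : inner ℝ (lp.single 2 ⟨r, hr⟩ (1 : ℝ) : lp (fun _ : {r | 0 < v r} => ℝ) 2)
      (lp.single 2 ⟨s, hs⟩ (1 : ℝ)) / (Real.sqrt (v r) * Real.sqrt (v s)) =
      if r = s then (v r)⁻¹ else 0 := by
    rw [lp.inner_single_left]
    split_ifs with h
    · subst h
      rw [Real.mul_self_sqrt hr.le]
      simp
    · rw [lp.single_apply_ne _ _ _ (by simpa using h)]
      simp
  rw [e] at h2
  refine h2.congr_fun fun n => ?_
  have h1 := (Real.sqrt_pos.2 hr).ne'
  have h2 := (Real.sqrt_pos.2 hs).ne'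
  have h3 := (Real.sqrt_pos.2 (hnorm n)).ne'
  nth_rw 1 [← Real.mul_self_sqrt (hnorm n).le]
  simp only [dualFun]
  field_simp

/-- Dual completeness. -/
theorem eq_zero_of_dual {y : ℕ → ℝ} (hy : Summable fun n => y n ^ 2)
    (h : ∀ r, 0 < v r → ∑' n, y n * ((q n).eval (r : ℝ) /
      Real.sqrt (momentFunctional v hv (q n * q n))) = 0) (n : ℕ) : y n = 0 := by
  set b := dualBasis hv hv0 hdeg horth hnorm with hb
  let Y : lp (fun _ : ℕ => ℝ) 2 := ⟨y, memℓp_gen (by simpa using hy)⟩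
  have hg := b.hasSum_repr_symm Y
  -- The vector with coordinates y vanishes at every point r of the support; being zero, it has zero
  -- coordinates.
  have h0 : b.repr.symm Y = 0 := by
    ext r
    have h1 := hg.mapL (innerSL ℝ (lp.single 2 r (1 : ℝ) : lp (fun _ : {r | 0 < v r} => ℝ) 2))
    simp only [map_smul, innerSL_apply_apply, hb, inner_single_dualBasis, smul_eq_mul] at h1
    rw [lp.inner_single_left] at h1
    have h2 := h r r.2
    have h3 : ∑' n, Y n * dualFun (q := q) hv n r = 0 := by
      have : ∀ n, Y n * dualFun (q := q) hv n r = Real.sqrt (v r) * (y n * ((q n).eval (r : ℝ) /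
        Real.sqrt (momentFunctional v hv (q n * q n)))) := fun n => by
        change y n * dualFun (q := q) hv n r = _
        rw [dualFun]; ring
      simp only [this]
      rw [tsum_mul_left, h2, mul_zero]
    have h4 := h1.tsum_eq
    rw [h3] at h4
    simpa [hb] using h4.symm
  have hY : Y = 0 := by simpa using h0
  exact congrArg (fun Z : lp (fun _ : ℕ => ℝ) 2 => Z n) hY

end Dual

/-! ### The determinants as Christoffel determinants of the dual polynomials -/

/-- The zeros `f ∈ F₁` and `-c - f`, `f ∈ F₂`, of the Christoffel factor. -/
def nodes (c : ℝ) (F₁ F₂ : Finset ℕ) : Fin (F₁.card + F₂.card) → ℝ :=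
  Fin.append (fun i => (F₁.orderEmbOfFin rfl i : ℝ)) (fun i => -c - (F₂.orderEmbOfFin rfl i : ℝ))

/-- The Christoffel factor `∏ (x - f) ∏ (x + c + f)`. -/
def christoffelFactor (c : ℝ) (F₁ F₂ : Finset ℕ) : ℝ[X] := ∏ i, (X - C (nodes c F₁ F₂ i))

/-- The factors that the duality of Meixner polynomials splits off from the rows. -/
def rowFactor (a c : ℝ) (F₁ F₂ : Finset ℕ) (x : ℕ) : Fin (F₁.card + F₂.card) → ℝ :=
  Fin.append (fun i => normFactor a c (F₁.orderEmbOfFin rfl i))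
    (fun i => normFactor (1 / a) c (F₂.orderEmbOfFin rfl i) * a ^ x)

/-- The product of all row factors. -/
def rowProd (a c : ℝ) (F₁ F₂ : Finset ℕ) (x : ℕ) : ℝ := ∏ i, rowFactor a c F₁ F₂ x i

/-- The masses of the Christoffel transform of the Meixner measure. -/
def christoffelWeight (a c : ℝ) (F₁ F₂ : Finset ℕ) (r : ℕ) : ℝ :=
  (christoffelFactor c F₁ F₂).eval (r : ℝ) * meixnerWeight a c r

lemma prod_orderEmbOfFin (F : Finset ℕ) (g : ℕ → ℝ) :
    ∏ i : Fin F.card, g (F.orderEmbOfFin rfl i) = ∏ f ∈ F, g f := by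
  conv_rhs => rw [← F.map_orderEmbOfFin_univ rfl]
  rw [Finset.prod_map]
  rfl

lemma eval_christoffelFactor (c : ℝ) (F₁ F₂ : Finset ℕ) (x : ℝ) :
    (christoffelFactor c F₁ F₂).eval x = (∏ f ∈ F₁, (x - f)) * ∏ f ∈ F₂, (x + c + f) := by
  rw [christoffelFactor, eval_prod, Fin.prod_univ_add]
  simp only [nodes, Fin.append_left, Fin.append_right, eval_sub, eval_X, eval_C]
  rw [prod_orderEmbOfFin F₁ fun f => x - f, prod_orderEmbOfFin F₂ fun f => x - (-c - f)]
  congr 1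
  exact Finset.prod_congr rfl fun f _ => by ring

/-- Only the rows from F₂ depend on x. This relates the factors of `Omega` at x and x + 1, and
produces the power a^{k₂} in the dual constant. -/
lemma rowProd_eq (a c : ℝ) (F₁ F₂ : Finset ℕ) (x : ℕ) :
    rowProd a c F₁ F₂ x = rowProd a c F₁ F₂ 0 * a ^ (x * F₂.card) := by
  simp [rowProd, Fin.prod_univ_add, rowFactor, Finset.prod_mul_distrib, pow_mul, mul_assoc]

section

variable {a c : ℝ} (ha₀ : 0 < a) (ha₁ : a < 1) (hc : ∀ j : ℕ, c ≠ -(j : ℝ)) {F₁ F₂ : Finset ℕ}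

include hc in
lemma injective_nodes : Function.Injective (nodes c F₁ F₂) := by
  rw [nodes, Fin.append_injective_iff]
  refine ⟨fun i j h => ?_, fun i j h => ?_, fun i j h => ?_⟩
  · simpa using h
  · simpa using h
  · exact hc (F₁.orderEmbOfFin rfl i + F₂.orderEmbOfFin rfl j) (by push_cast; linarith)

include ha₀ ha₁ hc

lemma rowProd_ne_zero (x : ℕ) : rowProd a c F₁ F₂ x ≠ 0 := by
  refine Finset.prod_ne_zero_iff.2 fun i _ => ?_
  refine Fin.addCases (fun i => ?_) (fun i => ?_) i
  · simp only [rowFactor, Fin.append_left]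
    exact normFactor_ne_zero ha₀.ne' ha₁.ne hc _
  · simp only [rowFactor, Fin.append_right]
    exact mul_ne_zero (normFactor_ne_zero (one_div_ne_zero ha₀.ne')
      (by rw [Ne, div_eq_iff ha₀.ne']; linarith) hc _) (by positivity)

lemma eval_row₁ (n x j : ℕ) :
    (row₁ a c n j).eval (x : ℝ) = normFactor a c n * (hypMeixner a c (x + j)).eval (n : ℝ) := by
  rw [row₁, eval_comp, eval_add, eval_X, eval_C, ← Nat.cast_add, eval_meixner ha₀.ne' ha₁.ne hc,
    hypMeixner_duality]

lemma eval_row₂ (f x j : ℕ) : (row₂ a c f j).eval (x : ℝ) =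
    normFactor (1 / a) c f * a ^ x * (hypMeixner a c (x + j)).eval (-c - f) := by
  rw [row₂, eval_mul, eval_C, eval_comp, eval_add, eval_X, eval_C, ← Nat.cast_add,
    eval_meixner (one_div_ne_zero ha₀.ne') (by rw [Ne, div_eq_iff ha₀.ne']; linarith) hc,
    eval_hypMeixner_inv ha₀.ne' hc, pow_add]
  field_simp

lemma eval_rowsF (i : Fin (F₁.card + F₂.card)) (x j : ℕ) : (rowsF a c F₁ F₂ i j).eval (x : ℝ) =
    rowFactor a c F₁ F₂ x i * (hypMeixner a c (x + j)).eval (nodes c F₁ F₂ i) := by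
  refine Fin.addCases (fun i => ?_) (fun i => ?_) i
  · simp only [rowsF, rowFactor, nodes, Fin.append_left]
    exact eval_row₁ ha₀ ha₁ hc _ _ _
  · simp only [rowsF, rowFactor, nodes, Fin.append_right]
    exact eval_row₂ ha₀ ha₁ hc _ _ _

lemma eval_Omega (x : ℕ) : (Omega a c F₁ F₂).eval (x : ℝ) =
    rowProd a c F₁ F₂ x * casorati (hypMeixner a c) (nodes c F₁ F₂) x := by
  rw [Omega, ← coe_evalRingHom, RingHom.map_det, rowProd, casorati, ← Matrix.det_mul_column]
  congr 1
  ext i j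
  simpa using eval_rowsF ha₀ ha₁ hc i x j

/-- Here r is the variable and x the degree index. Natural x suffice, since the measure lives on ℕ.
-/
lemma eval_excMeixner (r x : ℕ) : (excMeixner a c F₁ F₂ (uF F₁ F₂ + r)).eval (x : ℝ) =
    normFactor a c r * rowProd a c F₁ F₂ x *
      (christoffel (hypMeixner a c) (nodes c F₁ F₂) x).eval (r : ℝ) := by
  have hprod : normFactor a c r * rowProd a c F₁ F₂ x =
      ∏ i, (Fin.cons (normFactor a c r) (rowFactor a c F₁ F₂ x) :
        Fin (F₁.card + F₂.card + 1) → ℝ) i := by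
    rw [Fin.prod_univ_succ]; simp [rowProd]
  rw [excMeixner, ← coe_evalRingHom, RingHom.map_det, eval_christoffel, hprod,
    ← Matrix.det_mul_column]
  congr 1
  ext i j
  refine Fin.cases ?_ (fun i => ?_) i
  · simpa using eval_row₁ ha₀ ha₁ hc r x j
  · simpa using eval_rowsF ha₀ ha₁ hc i x j

lemma expDecay_christoffelWeight : ExpDecay (christoffelWeight a c F₁ F₂) :=
  (expDecay_meixnerWeight ha₀ ha₁ hc).eval_mul _

lemma functional_christoffelWeight (p : ℝ[X]) :
    momentFunctional _ (expDecay_christoffelWeight ha₀ ha₁ hc (F₁ := F₁) (F₂ := F₂)) p =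
      momentFunctional _ (expDecay_meixnerWeight ha₀ ha₁ hc) (christoffelFactor c F₁ F₂ * p) := by
  rw [momentFunctional_apply, momentFunctional_apply]
  refine tsum_congr fun x => ?_
  rw [christoffelWeight, eval_mul]
  ring

omit ha₁ in
lemma meixnerWeight_ne_zero (x : ℕ) : meixnerWeight a c x ≠ 0 := by
  have := Real.Gamma_ne_zero (s := x + c) fun m => by
    rw [add_comm]; exact ne_neg_nat_add hc x m
  rw [meixnerWeight]
  positivity

omit ha₀ ha₁ in
lemma eval_christoffelFactor_ne_zero {r : ℕ} (hr : r ∉ F₁) :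
    (christoffelFactor c F₁ F₂).eval (r : ℝ) ≠ 0 := by
  rw [eval_christoffelFactor]
  refine mul_ne_zero (Finset.prod_ne_zero_iff.2 fun f hf => ?_)
    (Finset.prod_ne_zero_iff.2 fun f _ h => hc (r + f) (by push_cast; linarith))
  rw [sub_ne_zero]
  exact_mod_cast fun h : r = f => hr (h ▸ hf)

variable (hadm : Admissible c F₁ F₂)

include hadm

omit ha₁ in
-- With m = max(-⌊c⌋, 0) one has c + m > 0, so Γ(r+c) (r+c)_m = Γ(r+c+m) > 0. Thus Γ(r+c) has the
-- sign of the denominator in the admissibility condition.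
lemma christoffelWeight_nonneg (r : ℕ) : 0 ≤ christoffelWeight a c F₁ F₂ r := by
  have h := hadm r
  rw [← eval_christoffelFactor] at h
  set m := (-⌊c⌋).toNat with hm
  have hrc : ∀ j : ℕ, (r : ℝ) + c ≠ -(j : ℝ) := fun j => by
    rw [add_comm]; exact ne_neg_nat_add hc r j
  have hpos : 0 < (r : ℝ) + c + m := by
    have h1 : (-(⌊c⌋ : ℝ)) ≤ m := by
      have : -⌊c⌋ ≤ (m : ℤ) := Int.self_le_toNat _
      exact_mod_cast this
    have h2 := Int.floor_le c
    have h3 : c + m ≠ 0 := fun h => hc m (by linarith)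
    have h4 : 0 < c + m := lt_of_le_of_ne (by linarith) h3.symm
    have h5 : (0 : ℝ) ≤ r := Nat.cast_nonneg r
    linarith
  have hG := Real.Gamma_pos_of_pos hpos
  rw [Gamma_add_nat hrc] at hG
  have hp := poch_ne_zero hrc m
  rw [← poch] at h
  have e : christoffelWeight a c F₁ F₂ r = ((christoffelFactor c F₁ F₂).eval (r : ℝ) /
      poch (r + c) m) * (Real.Gamma (r + c) * poch (r + c) m) * (a ^ r / r.factorial) := by
    rw [christoffelWeight, meixnerWeight]
    field_simp
  rw [e]
  have := mul_nonneg h hG.le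
  positivity

omit ha₁ in
lemma christoffelWeight_pos {r : ℕ} (hr : r ∉ F₁) : 0 < christoffelWeight a c F₁ F₂ r :=
  lt_of_le_of_ne (christoffelWeight_nonneg ha₀ hc hadm r)
    (mul_ne_zero (eval_christoffelFactor_ne_zero hc hr) (meixnerWeight_ne_zero ha₀ hc r)).symm

omit ha₀ ha₁ hc hadm in
lemma notMem_of_christoffelWeight_pos {r : ℕ} (hr : 0 < christoffelWeight a c F₁ F₂ r) :
    r ∉ F₁ := fun h => by
  rw [christoffelWeight, eval_christoffelFactor, Finset.prod_eq_zero h (sub_self _)] at hr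
  simp at hr

lemma functional_christoffelFactor_pos (p : ℝ[X]) (hp : p ≠ 0) :
    0 < momentFunctional _ (expDecay_meixnerWeight ha₀ ha₁ hc)
      (christoffelFactor c F₁ F₂ * p * p) := by
  have hterm : ∀ x : ℕ, (p * p).eval (x : ℝ) * christoffelWeight a c F₁ F₂ x =
      p.eval (x : ℝ) ^ 2 * christoffelWeight a c F₁ F₂ x := fun x => by rw [eval_mul, pow_two]
  have hnn : ∀ x : ℕ, 0 ≤ (p * p).eval (x : ℝ) * christoffelWeight a c F₁ F₂ x := fun x => by
    rw [hterm]
    exact mul_nonneg (sq_nonneg _) (christoffelWeight_nonneg ha₀ hc hadm x)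
  -- A nonzero polynomial cannot vanish on all of ℕ; including the Christoffel factor provides a
  -- point where both p and the weight are nonzero.
  have hne : christoffelFactor c F₁ F₂ * p ≠ 0 := mul_ne_zero monic_nodes.ne_zero hp
  obtain ⟨x, hx⟩ : ∃ x : ℕ, (christoffelFactor c F₁ F₂ * p).eval (x : ℝ) ≠ 0 := by
    by_contra! h
    refine hne (eq_zero_of_infinite_isRoot _ ((Set.infinite_range_of_injective
      (Nat.cast_injective (R := ℝ))).mono ?_))
    rintro _ ⟨x, rfl⟩
    exact h x
  rw [eval_mul, mul_ne_zero_iff] at hx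
  rw [mul_assoc, ← functional_christoffelWeight ha₀ ha₁ hc, momentFunctional_apply]
  refine ((expDecay_christoffelWeight ha₀ ha₁ hc).summable_eval_mul _).tsum_pos hnn x ?_
  refine lt_of_le_of_ne (hnn x) (Ne.symm ?_)
  rw [hterm]
  exact mul_ne_zero (pow_ne_zero _ hx.2) (mul_ne_zero hx.1 (meixnerWeight_ne_zero ha₀ hc x))

/-- The exceptional Meixner polynomials and their weight in terms of the orthogonal polynomials
with respect to the Christoffel transform of the Meixner measure. -/
theorem exists_dual_family : ∃ q : ℕ → ℝ[X], (∀ n, (q n).degree = n) ∧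
    (∀ n m, n ≠ m → momentFunctional _ (expDecay_christoffelWeight ha₀ ha₁ hc (F₁ := F₁) (F₂ := F₂))
      (q n * q m) = 0) ∧
    (∀ n, 0 < momentFunctional _ (expDecay_christoffelWeight ha₀ ha₁ hc (F₁ := F₁) (F₂ := F₂))
      (q n * q n)) ∧
    (∀ x, omegaMass a c F₁ F₂ x = ((1 - a) / a) ^ (F₁.card + F₂.card) * Real.Gamma c ^ 2 *
      (1 - a) ^ (-c) / a ^ F₂.card / (rowProd a c F₁ F₂ x ^ 2 *
        momentFunctional _ (expDecay_christoffelWeight ha₀ ha₁ hc (F₁ := F₁) (F₂ := F₂))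
          (q x * q x))) ∧
    ∀ r x : ℕ, (excMeixner a c F₁ F₂ (uF F₁ F₂ + r)).eval (x : ℝ) =
      normFactor a c r * rowProd a c F₁ F₂ x *
        ((christoffelFactor c F₁ F₂).eval (r : ℝ) * (q x).eval (r : ℝ)) := by
  have hpos := functional_christoffelFactor_pos ha₀ ha₁ hc hadm
  obtain ⟨q, hq, hdeg, horth, hnorm⟩ := exists_christoffel_transform
    (injective_nodes hc (F₁ := F₁) (F₂ := F₂)) (degree_hypMeixner ha₀ ha₁ hc)
    (functional_hypMeixner_mul ha₀ ha₁ hc) hpos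
  have hcas := casorati_ne_zero (injective_nodes hc (F₁ := F₁) (F₂ := F₂))
    (degree_hypMeixner ha₀ ha₁ hc) (functional_hypMeixner_mul ha₀ ha₁ hc) hpos
  have hq0 : ∀ n, q n ≠ 0 := fun n h => by simpa [h] using hdeg n
  refine ⟨q, hdeg, fun n m hnm => ?_, fun n => ?_, fun x => ?_, fun r x => ?_⟩
  · rw [functional_christoffelWeight ha₀ ha₁ hc, ← mul_assoc]
    exact horth n m hnm
  · rw [functional_christoffelWeight ha₀ ha₁ hc, ← mul_assoc]
    exact hpos _ (hq0 n)
  · rw [functional_christoffelWeight ha₀ ha₁ hc, ← mul_assoc, christoffelFactor, hnorm x,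
      leadingCoeff_hypMeixner ha₀ ha₁ hc, leadingCoeff_hypMeixner ha₀ ha₁ hc,
      functional_hypMeixner_sq ha₀ ha₁ hc, omegaMass, ← Nat.cast_succ, eval_Omega ha₀ ha₁ hc,
      eval_Omega ha₀ ha₁ hc, rowProd_eq a c F₁ F₂ (x + 1), rowProd_eq a c F₁ F₂ x]
    have hG : Real.Gamma (x + c + (F₁.card + F₂.card : ℕ)) =
        Real.Gamma c * poch c (x + (F₁.card + F₂.card)) := by
      rw [← Gamma_add_nat hc]; congr 1; push_cast; ring
    rw [hG]
    have h1 := rowProd_ne_zero ha₀ ha₁ hc (F₁ := F₁) (F₂ := F₂) 0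
    have h2 := hcas x
    have h3 := hcas (x + 1)
    have h4 := poch_ne_zero hc x
    have h5 := poch_ne_zero hc (x + (F₁.card + F₂.card))
    have h6 : Real.Gamma c ≠ 0 := Real.Gamma_ne_zero hc
    have h7 : (0 : ℝ) < 1 - a := by linarith
    have h8 : (1 - a) ^ (-c) ≠ 0 := (Real.rpow_pos_of_pos h7 _).ne'
    -- The sign (-1)^k from the ratio of leading coefficients cancels the one in Christoffel's norm
    -- formula, leaving the positive ((1-a)/a)^k.
    have e1 : 1 - 1 / a = (-1) * ((1 - a) / a) := by field_simp; ring
    have h9 : (1 - a) / a ≠ 0 := (div_pos h7 ha₀).ne'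
    have e2 : ((-1 : ℝ)) ^ (F₁.card + F₂.card) * (-1) ^ (F₁.card + F₂.card) = 1 := by
      rw [← pow_add]; exact Even.neg_one_pow ⟨_, rfl⟩
    rw [e1, mul_pow (-1 : ℝ) _ (x + _), mul_pow (-1 : ℝ) _ x, pow_add (-1 : ℝ) x,
      pow_add ((1 - a) / a) x]
    generalize casorati (hypMeixner a c) (nodes c F₁ F₂) x = D₀ at h2 ⊢
    generalize casorati (hypMeixner a c) (nodes c F₁ F₂) (x + 1) = D₁ at h3 ⊢
    generalize rowProd a c F₁ F₂ 0 = R at h1 ⊢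
    generalize (1 - a) / a = B at h9 ⊢
    generalize (1 - a) ^ (-c) = A at h8 ⊢
    generalize F₁.card + F₂.card = k at h5 e2 ⊢
    generalize F₂.card = k₂
    generalize poch c (x + k) = p₁ at h5 ⊢
    generalize poch c x = p₀ at h4 ⊢
    have h10 : ((-1 : ℝ)) ^ k ≠ 0 := by simp
    generalize ((-1 : ℝ)) ^ k = ε at e2 h10 ⊢
    rw [show (x + 1) * k₂ = x * k₂ + k₂ by ring, pow_add a]
    have h11 : ((-1 : ℝ)) ^ x ≠ 0 := by simp
    generalize ((-1 : ℝ)) ^ x = δ at h11 ⊢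
    field_simp
    linear_combination e2
  · rw [eval_excMeixner ha₀ ha₁ hc, hq, eval_mul]
    rfl

end

/-! ### Discrete measures on the nonnegative integers -/

section Discrete

variable {E : Type*} [NormedAddCommGroup E] {m : ℕ → ℝ} (hm : ∀ x, 0 ≤ m x)
  {f : ℝ → E}

include hm in
lemma integral_smul_dirac [NormedSpace ℝ E] [CompleteSpace E] (f : ℝ → E) (x : ℕ) :
    ∫ t, f t ∂(ENNReal.ofReal (m x) • Measure.dirac (x : ℝ)) = m x • f x := by
  rw [integral_smul_measure, integral_dirac, ENNReal.toReal_ofReal (hm x)]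

lemma integrable_smul_dirac (m : ℕ → ℝ) (f : ℝ → E) (x : ℕ) :
    Integrable f (ENNReal.ofReal (m x) • Measure.dirac (x : ℝ)) :=
  (integrable_dirac (by simp)).smul_measure ENNReal.ofReal_ne_top

include hm in
lemma integrable_discrete (h : Summable fun x : ℕ => m x * ‖f x‖) :
    Integrable f (Measure.sum fun x : ℕ => ENNReal.ofReal (m x) • Measure.dirac (x : ℝ)) := by
  refine integrable_sum_measure (integrable_smul_dirac m f) (h.congr fun x => ?_)
  rw [integral_smul_dirac hm, smul_eq_mul]

include hm in
lemma hasSum_integral_discrete [NormedSpace ℝ E] [CompleteSpace E] (h : Integrable f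
    (Measure.sum fun x : ℕ => ENNReal.ofReal (m x) • Measure.dirac (x : ℝ))) :
    HasSum (fun x : ℕ => m x • f x)
      (∫ t, f t ∂(Measure.sum fun x : ℕ => ENNReal.ofReal (m x) • Measure.dirac (x : ℝ))) := by
  refine (hasSum_integral_measure h).congr_fun fun x => ?_
  rw [integral_smul_dirac hm]

lemma ae_discrete {p : ℝ → Prop} (h : ∀ x : ℕ, p x) :
    ∀ᵐ t ∂(Measure.sum fun x : ℕ => ENNReal.ofReal (m x) • Measure.dirac (x : ℝ)), p t := by
  rw [Measure.ae_sum_eq, Filter.eventually_iSup]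
  intro x
  refine Measure.ae_smul_measure ?_ _
  rw [ae_dirac_eq]
  exact h x

end Discrete

/-- A real polynomial without zeros on the nonnegative integers is bounded away from zero there. -/
lemma exists_pos_le_abs_eval (p : ℝ[X]) (hp : ∀ x : ℕ, p.eval (x : ℝ) ≠ 0) :
    ∃ ε > 0, ∀ x : ℕ, ε ≤ |p.eval (x : ℝ)| := by
  have h : ∃ N : ℕ, ∃ δ > 0, ∀ x : ℕ, N ≤ x → δ ≤ |p.eval (x : ℝ)| := by
    rcases le_or_gt p.degree 0 with hd | hd
    · rw [eq_C_of_degree_le_zero hd]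
      refine ⟨0, |p.coeff 0|, ?_, fun x _ => by simp⟩
      have := hp 0
      rw [eq_C_of_degree_le_zero hd] at this
      simpa using this
    · have := ((p.abs_tendsto_atTop hd).comp tendsto_natCast_atTop_atTop).eventually_ge_atTop 1
      obtain ⟨N, hN⟩ := Filter.eventually_atTop.1 this
      exact ⟨N, 1, one_pos, hN⟩
  obtain ⟨N, δ, hδ, hN⟩ := h
  obtain ⟨δ', hδ', hN'⟩ : ∃ δ' > 0, ∀ x : ℕ, x < N → δ' ≤ |p.eval (x : ℝ)| := by
    clear hN
    induction N with
    | zero => exact ⟨1, one_pos, fun x hx => absurd hx (Nat.not_lt_zero x)⟩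
    | succ N ih =>
      obtain ⟨δ', h0, h1⟩ := ih
      refine ⟨min δ' |p.eval (N : ℝ)|, lt_min h0 (abs_pos.2 (hp N)), fun x hx => ?_⟩
      rcases Nat.lt_succ_iff_lt_or_eq.1 hx with h | rfl
      · exact (min_le_left _ _).trans (h1 x h)
      · exact min_le_right _ _
  refine ⟨min δ δ', lt_min hδ hδ', fun x => ?_⟩
  rcases lt_or_ge x N with h | h
  · exact (min_le_right _ _).trans (hN' x h)
  · exact (min_le_left _ _).trans (hN x h)

/-! ### Positivity, orthogonality, norms and completeness of the exceptional polynomials -/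

section

variable {a c : ℝ} (ha₀ : 0 < a) (ha₁ : a < 1) (hc : ∀ j : ℕ, c ≠ -(j : ℝ)) {F₁ F₂ : Finset ℕ}
  (hadm : Admissible c F₁ F₂)

include ha₀ ha₁ hc

/-- The constant in the dual description of the weight is positive. -/
lemma dualConst_pos (k k₂ : ℕ) :
    0 < ((1 - a) / a) ^ k * Real.Gamma c ^ 2 * (1 - a) ^ (-c) / a ^ k₂ := by
  have h7 : (0 : ℝ) < 1 - a := by linarith
  have h6 : Real.Gamma c ≠ 0 := Real.Gamma_ne_zero hc
  have h8 := Real.rpow_pos_of_pos h7 (-c)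
  positivity

include hadm

lemma omegaMass_pos (x : ℕ) : 0 < omegaMass a c F₁ F₂ x := by
  obtain ⟨q, -, -, hnorm, hmass, -⟩ := exists_dual_family ha₀ ha₁ hc hadm
  rw [hmass]
  have h1 := rowProd_ne_zero ha₀ ha₁ hc (F₁ := F₁) (F₂ := F₂) x
  exact div_pos (dualConst_pos ha₀ ha₁ hc _ _) (mul_pos (by positivity) (hnorm x))

lemma expDecay_omegaMass : ExpDecay (omegaMass a c F₁ F₂) := by
  have hpos := omegaMass_pos ha₀ ha₁ hc hadm
  -- Division by zero yields 0, so a zero of `Omega` at x would contradict the positivity of the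
  -- mass.
  have hΩ : ∀ x : ℕ, (Omega a c F₁ F₂).eval (x : ℝ) ≠ 0 := fun x h => by
    have := hpos x
    simp [omegaMass, h] at this
  obtain ⟨ε, hε, hle⟩ := exists_pos_le_abs_eval _ hΩ
  have hck := ne_neg_nat_add hc (F₁.card + F₂.card)
  refine (expDecay_poch ha₀ ha₁ (c + (F₁.card + F₂.card : ℕ))).mono
    (K := |Real.Gamma (c + (F₁.card + F₂.card : ℕ))| / (ε * ε)) fun x => ?_
  have e : omegaMass a c F₁ F₂ x = Real.Gamma (c + (F₁.card + F₂.card : ℕ)) *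
      (a ^ x * poch (c + (F₁.card + F₂.card : ℕ)) x / x.factorial) /
      ((Omega a c F₁ F₂).eval (x : ℝ) * (Omega a c F₁ F₂).eval ((x + 1 : ℕ) : ℝ)) := by
    rw [omegaMass, show (x : ℝ) + c + (F₁.card + F₂.card : ℕ) = c + (F₁.card + F₂.card : ℕ) + x by
      ring, Gamma_add_nat hck, Nat.cast_succ]
    have h1 := hΩ x
    have h2 := hΩ (x + 1)
    rw [Nat.cast_succ] at h2
    field_simp
  rw [e, abs_div, abs_mul, abs_mul ((Omega a c F₁ F₂).eval _), div_mul_eq_mul_div]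
  gcongr
  · exact hle x
  · exact hle (x + 1)

lemma integrable_eval_omegaMeasure (p : ℝ[X]) :
    Integrable (fun t => p.eval t) (omegaMeasure a c F₁ F₂) := by
  refine integrable_discrete (fun x => (omegaMass_pos ha₀ ha₁ hc hadm x).le) ?_
  refine ((expDecay_omegaMass ha₀ ha₁ hc hadm).summable_eval_mul p).abs.congr fun x => ?_
  rw [abs_mul, abs_of_pos (omegaMass_pos ha₀ ha₁ hc hadm x), mul_comm, Real.norm_eq_abs]

/-- Orthogonality of the exceptional Meixner polynomials. -/
lemma integral_excMeixner_mul (r s : ℕ) (hr : r ∉ F₁) (hs : s ∉ F₁) :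
    ∫ t, (excMeixner a c F₁ F₂ (uF F₁ F₂ + r)).eval t *
      (excMeixner a c F₁ F₂ (uF F₁ F₂ + s)).eval t ∂(omegaMeasure a c F₁ F₂) =
      if r = s then ((1 - a) / a) ^ (F₁.card + F₂.card) * Real.Gamma c ^ 2 * (1 - a) ^ (-c) /
        a ^ F₂.card * normFactor a c r ^ 2 * (christoffelFactor c F₁ F₂).eval (r : ℝ) ^ 2 /
          christoffelWeight a c F₁ F₂ r else 0 := by
  obtain ⟨q, hdeg, horth, hnorm, hmass, hexc⟩ := exists_dual_family ha₀ ha₁ hc hadm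
  have hdual := hasSum_dual (expDecay_christoffelWeight ha₀ ha₁ hc)
    (christoffelWeight_nonneg ha₀ hc hadm) hdeg horth hnorm r s
    (christoffelWeight_pos ha₀ hc hadm hr) (christoffelWeight_pos ha₀ hc hadm hs)
  have hint := hasSum_integral_discrete (fun x => (omegaMass_pos ha₀ ha₁ hc hadm x).le)
    (integrable_eval_omegaMeasure ha₀ ha₁ hc hadm (excMeixner a c F₁ F₂ (uF F₁ F₂ + r) *
      excMeixner a c F₁ F₂ (uF F₁ F₂ + s)))
  -- The multiplier is chosen because the mass at x times the squared row product is the dual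
  -- constant over ‖q_x‖²; the row products of the two polynomials thus cancel.
  have hdual' := hdual.mul_left (((1 - a) / a) ^ (F₁.card + F₂.card) * Real.Gamma c ^ 2 *
    (1 - a) ^ (-c) / a ^ F₂.card * (normFactor a c r * normFactor a c s) *
    ((christoffelFactor c F₁ F₂).eval (r : ℝ) * (christoffelFactor c F₁ F₂).eval (s : ℝ)))
  have := (hdual'.congr_fun fun x => ?_).unique hint
  · simp only [eval_mul] at this
    rw [omegaMeasure, ← this]
    split_ifs with h
    · subst h
      rw [div_eq_mul_inv _ (christoffelWeight a c F₁ F₂ r)]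
      ring
    · rw [mul_zero]
  · have h1 := rowProd_ne_zero ha₀ ha₁ hc (F₁ := F₁) (F₂ := F₂) x
    have h2 := (hnorm x).ne'
    rw [smul_eq_mul, eval_mul, hexc, hexc, hmass]
    generalize ((1 - a) / a) ^ (F₁.card + F₂.card) * Real.Gamma c ^ 2 * (1 - a) ^ (-c) /
      a ^ F₂.card = K
    field_simp

lemma integral_excMeixner_sq_pos (r : ℕ) (hr : r ∉ F₁) :
    0 < ∫ t, (excMeixner a c F₁ F₂ (uF F₁ F₂ + r)).eval t ^ 2 ∂(omegaMeasure a c F₁ F₂) := by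
  simp only [pow_two]
  rw [integral_excMeixner_mul ha₀ ha₁ hc hadm r r hr hr, if_pos rfl]
  have h1 := normFactor_ne_zero ha₀.ne' ha₁.ne hc r
  have h2 := eval_christoffelFactor_ne_zero hc hr (F₂ := F₂)
  exact div_pos (mul_pos (mul_pos (dualConst_pos ha₀ ha₁ hc _ _) (by positivity)) (by positivity))
    (christoffelWeight_pos ha₀ hc hadm hr)

/-- Since Γ(c) `normFactor a c r` equals the Meixner weight at r over (a-1)^r, the quotient of
Christoffel factor and weight becomes their product, which is ρ. -/
lemma integral_excMeixner_sq (r : ℕ) (hr : r ∉ F₁) :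
    ∫ t, (excMeixner a c F₁ F₂ (uF F₁ F₂ + r)).eval t ^ 2 ∂(omegaMeasure a c F₁ F₂) =
      a ^ ((F₁.card : ℤ) - 2 * ((F₁.card : ℤ) + (F₂.card : ℤ))) /
        (1 - a) ^ (c + 2 * ((uF F₁ F₂ + r : ℕ) : ℝ) - 2 * (uF F₁ F₂ : ℝ) -
          ((F₁.card + F₂.card : ℕ) : ℝ)) * rhoMass a c F₁ F₂ (uF F₁ F₂ + r) := by
  simp only [pow_two]
  rw [integral_excMeixner_mul ha₀ ha₁ hc hadm r r hr hr, if_pos rfl]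
  have h7 : (0 : ℝ) < 1 - a := by linarith
  have hrho : rhoMass a c F₁ F₂ (uF F₁ F₂ + r) =
      (christoffelFactor c F₁ F₂).eval (r : ℝ) * meixnerWeight a c r := by
    rw [rhoMass, eval_christoffelFactor, meixnerWeight, Nat.add_sub_cancel_left]
    push_cast
    congr 1
    · congr 1
      · exact Finset.prod_congr rfl fun f _ => by ring
      · exact Finset.prod_congr rfl fun f _ => by ring
    · rw [show (uF F₁ F₂ : ℝ) + r + c - uF F₁ F₂ = r + c by ring]
  have ez : a ^ ((F₁.card : ℤ) - 2 * ((F₁.card : ℤ) + (F₂.card : ℤ))) =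
      1 / (a ^ (F₁.card + F₂.card) * a ^ F₂.card) := by
    rw [← pow_add, one_div, ← zpow_natCast, ← zpow_neg]
    congr 1
    push_cast
    ring
  have er : (1 - a) ^ (c + 2 * ((uF F₁ F₂ + r : ℕ) : ℝ) - 2 * (uF F₁ F₂ : ℝ) -
      ((F₁.card + F₂.card : ℕ) : ℝ)) =
      (1 - a) ^ (2 * r) / ((1 - a) ^ (-c) * (1 - a) ^ (F₁.card + F₂.card)) := by
    rw [← Real.rpow_natCast, ← Real.rpow_natCast, ← Real.rpow_add h7, ← Real.rpow_sub h7]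
    congr 1
    push_cast
    ring
  have h2 := eval_christoffelFactor_ne_zero hc hr (F₂ := F₂)
  have h3 := meixnerWeight_ne_zero ha₀ hc r
  have h8 := (Real.rpow_pos_of_pos h7 (-c)).ne'
  have h9 : a - 1 ≠ 0 := by linarith
  have h10 := poch_ne_zero hc r
  have hw := meixnerWeight_eq hc (a := a) r
  have hsq : (a - 1) ^ 2 = (1 - a) ^ 2 := by ring
  rw [hrho, ez, er, christoffelWeight, normFactor, hw, mul_pow, ← pow_mul, mul_comm r 2,
    div_pow a (a - 1), pow_mul (a - 1), hsq, ← pow_mul]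
  rw [hw] at h3
  generalize (1 - a) ^ (-c) = A at h8 ⊢
  have h6 : Real.Gamma c ≠ 0 := Real.Gamma_ne_zero hc
  rw [div_pow (1 - a)]
  field_simp
  ring

/-- Completeness of the exceptional Meixner polynomials, tested against a single function. -/
lemma eq_zero_of_tsum_excMeixner {g : ℕ → ℝ}
    (hg : Summable fun x => omegaMass a c F₁ F₂ x * g x ^ 2)
    (h : ∀ r ∉ F₁, ∑' x : ℕ, omegaMass a c F₁ F₂ x *
      ((excMeixner a c F₁ F₂ (uF F₁ F₂ + r)).eval (x : ℝ) * g x) = 0) (x : ℕ) : g x = 0 := by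
  obtain ⟨q, hdeg, horth, hnorm, hmass, hexc⟩ := exists_dual_family ha₀ ha₁ hc hadm
  set N : ℕ → ℝ := fun x => momentFunctional _
    (expDecay_christoffelWeight ha₀ ha₁ hc (F₁ := F₁) (F₂ := F₂)) (q x * q x) with hN
  have hM := omegaMass_pos ha₀ ha₁ hc hadm
  set K := ((1 - a) / a) ^ (F₁.card + F₂.card) * Real.Gamma c ^ 2 * (1 - a) ^ (-c) / a ^ F₂.card
    with hK
  have hK0 : 0 < K := dualConst_pos ha₀ ha₁ hc _ _
  have hR := rowProd_ne_zero ha₀ ha₁ hc (F₁ := F₁) (F₂ := F₂)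
  -- The square root of the mass sees only |`rowProd`|, so the sign of `rowProd` is put into the ℓ²
  -- sequence to which `eq_zero_of_dual` is applied.
  have hsqrt : ∀ x, g x * Real.sqrt (omegaMass a c F₁ F₂ x) * (rowProd a c F₁ F₂ x /
      |rowProd a c F₁ F₂ x|) / Real.sqrt (N x) * Real.sqrt K =
        omegaMass a c F₁ F₂ x * rowProd a c F₁ F₂ x * g x := by
    intro x
    have e : Real.sqrt (omegaMass a c F₁ F₂ x) =
        Real.sqrt K / (|rowProd a c F₁ F₂ x| * Real.sqrt (N x)) := by
      rw [hmass, Real.sqrt_div hK0.le, Real.sqrt_mul (sq_nonneg _), Real.sqrt_sq_eq_abs]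
    have h1 := Real.mul_self_sqrt (hM x).le
    have h2 : Real.sqrt K / (|rowProd a c F₁ F₂ x| * Real.sqrt (N x)) *
        Real.sqrt (omegaMass a c F₁ F₂ x) = omegaMass a c F₁ F₂ x := by rw [← e, h1]
    linear_combination (g x * rowProd a c F₁ F₂ x) * h2
  have hy := eq_zero_of_dual (expDecay_christoffelWeight ha₀ ha₁ hc)
    (christoffelWeight_nonneg ha₀ hc hadm) hdeg horth hnorm
    (y := fun x => g x * Real.sqrt (omegaMass a c F₁ F₂ x) *
      (rowProd a c F₁ F₂ x / |rowProd a c F₁ F₂ x|)) ?_ ?_ x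
  · have h1 := (Real.sqrt_pos.2 (hM x)).ne'
    have h2 := div_ne_zero (hR x) (abs_ne_zero.2 (hR x))
    simpa [h1, h2, hR x] using hy
  · refine hg.congr fun x => ?_
    rw [mul_pow, mul_pow, Real.sq_sqrt (hM x).le, div_pow, sq_abs, div_self (pow_ne_zero _ (hR x))]
    ring
  · intro r hr
    have hrF := notMem_of_christoffelWeight_pos hr
    have h1 := h r hrF
    have h2 : ∀ x : ℕ, omegaMass a c F₁ F₂ x *
        ((excMeixner a c F₁ F₂ (uF F₁ F₂ + r)).eval (x : ℝ) * g x) =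
        (normFactor a c r * (christoffelFactor c F₁ F₂).eval (r : ℝ) * Real.sqrt K) *
        (g x * Real.sqrt (omegaMass a c F₁ F₂ x) * (rowProd a c F₁ F₂ x /
          |rowProd a c F₁ F₂ x|) * ((q x).eval (r : ℝ) / Real.sqrt (N x))) := by
      intro x
      rw [hexc]
      linear_combination (-(normFactor a c r * (christoffelFactor c F₁ F₂).eval (r : ℝ) *
        (q x).eval (r : ℝ))) * hsqrt x
    simp only [h2] at h1
    rw [tsum_mul_left] at h1
    refine (mul_eq_zero.1 h1).resolve_left (mul_ne_zero (mul_ne_zero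
      (normFactor_ne_zero ha₀.ne' ha₁.ne hc r) (eval_christoffelFactor_ne_zero hc hrF))
      (Real.sqrt_pos.2 hK0).ne')

lemma memLp_eval_omegaMeasure (𝕜 : Type*) [RCLike 𝕜] (p : ℝ[X]) :
    MemLp (fun t : ℝ => ((p.eval t : ℝ) : 𝕜)) 2 (omegaMeasure a c F₁ F₂) := by
  refine (memLp_two_iff_integrable_sq_norm ?_).2 ?_
  · exact (RCLike.continuous_ofReal.comp p.continuous).aestronglyMeasurable
  · refine (integrable_eval_omegaMeasure ha₀ ha₁ hc hadm (p * p)).congr (ae_of_all _ fun t => ?_)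
    simp [pow_two]

/-- Completeness of the exceptional Meixner polynomials. -/
theorem isCompleteFamily_excMeixner (𝕜 : Type*) [RCLike 𝕜] :
    IsCompleteFamily 𝕜 (omegaMeasure a c F₁ F₂) (sigmaF F₁ F₂) (excMeixner a c F₁ F₂) := by
  have hM := omegaMass_pos ha₀ ha₁ hc hadm
  refine ⟨fun n => memLp_eval_omegaMeasure ha₀ ha₁ hc hadm 𝕜 _, ?_⟩
  rw [Submodule.dense_iff_topologicalClosure_eq_top, Submodule.topologicalClosure_eq_top_iff,
    eq_bot_iff]
  intro f hf
  have hsq : Summable fun x : ℕ => omegaMass a c F₁ F₂ x * ‖f (x : ℝ)‖ ^ 2 := by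
    have := (memLp_two_iff_integrable_sq_norm (Lp.aestronglyMeasurable f)).1 (Lp.memLp f)
    exact (hasSum_integral_discrete (fun x => (hM x).le) this).summable
  have hsum : ∀ r ∉ F₁, HasSum (fun x : ℕ => omegaMass a c F₁ F₂ x •
      ((((excMeixner a c F₁ F₂ (uF F₁ F₂ + r)).eval (x : ℝ) : ℝ) : 𝕜) * f (x : ℝ))) 0 := by
    intro r hr
    have hmem : uF F₁ F₂ + r ∈ sigmaF F₁ F₂ :=
      ⟨Nat.le_add_right _ _, fun g hg h => hr (by rwa [Nat.add_left_cancel h])⟩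
    have hp := memLp_eval_omegaMeasure ha₀ ha₁ hc hadm 𝕜 (excMeixner a c F₁ F₂ (uF F₁ F₂ + r))
    have h0 : inner 𝕜 (hp.toLp : Lp 𝕜 2 (omegaMeasure a c F₁ F₂)) f = 0 :=
      (Submodule.mem_orthogonal _ _).1 hf _ (Submodule.subset_span ⟨⟨_, hmem⟩, rfl⟩)
    have hae : (fun t => inner 𝕜 ((hp.toLp : Lp 𝕜 2 (omegaMeasure a c F₁ F₂)) t) (f t)) =ᵐ[omegaMeasure a c F₁ F₂]
        fun t => (((excMeixner a c F₁ F₂ (uF F₁ F₂ + r)).eval t : ℝ) : 𝕜) * f t := by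
      filter_upwards [hp.coeFn_toLp] with t ht
      rw [ht, RCLike.inner_apply, RCLike.conj_ofReal, mul_comm]
    rw [L2.inner_def, integral_congr_ae hae] at h0
    have hint := (L2.integrable_inner (𝕜 := 𝕜)
      (hp.toLp : Lp 𝕜 2 (omegaMeasure a c F₁ F₂)) f).congr hae
    rw [← h0]
    exact hasSum_integral_discrete (fun x => (hM x).le) hint
  -- The polynomials and masses are real, so the real and imaginary parts of f satisfy the
  -- orthogonality relations separately.
  have hre : ∀ x : ℕ, RCLike.re (f (x : ℝ)) = 0 := by
    refine eq_zero_of_tsum_excMeixner ha₀ ha₁ hc hadm ?_ fun r hr => ?_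
    · refine Summable.of_nonneg_of_le (fun x => mul_nonneg (hM x).le (sq_nonneg _)) (fun x => ?_) hsq
      refine mul_le_mul_of_nonneg_left ?_ (hM x).le
      rw [← sq_abs]
      exact pow_le_pow_left₀ (abs_nonneg _) (RCLike.abs_re_le_norm _) 2
    · have := (hsum r hr).mapL (RCLike.reCLM (K := 𝕜))
      simpa [RCLike.smul_re] using this.tsum_eq
  have him : ∀ x : ℕ, RCLike.im (f (x : ℝ)) = 0 := by
    refine eq_zero_of_tsum_excMeixner ha₀ ha₁ hc hadm ?_ fun r hr => ?_
    · refine Summable.of_nonneg_of_le (fun x => mul_nonneg (hM x).le (sq_nonneg _)) (fun x => ?_) hsq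
      refine mul_le_mul_of_nonneg_left ?_ (hM x).le
      rw [← sq_abs]
      exact pow_le_pow_left₀ (abs_nonneg _) (RCLike.abs_im_le_norm _) 2
    · have := (hsum r hr).mapL (RCLike.imCLM (K := 𝕜))
      simpa [RCLike.smul_im] using this.tsum_eq
  rw [Submodule.mem_bot, Lp.eq_zero_iff_ae_eq_zero]
  -- The measure is concentrated on ℕ, so vanishing there is vanishing almost everywhere.
  exact ae_discrete fun x => RCLike.ext (by simpa using hre x) (by simpa using him x)

omit ha₀ ha₁ hc hadm in
lemma exists_of_mem_sigmaF {n : ℕ} (hn : n ∈ sigmaF F₁ F₂) :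
    ∃ r, r ∉ F₁ ∧ n = uF F₁ F₂ + r := by
  obtain ⟨r, rfl⟩ := Nat.exists_eq_add_of_le hn.1
  exact ⟨r, fun h => hn.2 r h rfl, rfl⟩

theorem isOrthogonalFamily_excMeixner :
    IsOrthogonalFamily (omegaMeasure a c F₁ F₂) (sigmaF F₁ F₂) (excMeixner a c F₁ F₂) where
  moments j := by
    simpa using integrable_eval_omegaMeasure ha₀ ha₁ hc hadm (X ^ j)
  orthogonal n hn m hm hnm := by
    obtain ⟨r, hr, rfl⟩ := exists_of_mem_sigmaF hn
    obtain ⟨s, hs, rfl⟩ := exists_of_mem_sigmaF hm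
    rw [integral_excMeixner_mul ha₀ ha₁ hc hadm r s hr hs, if_neg fun h => hnm (by rw [h])]
  norm_pos n hn := by
    obtain ⟨r, hr, rfl⟩ := exists_of_mem_sigmaF hn
    exact integral_excMeixner_sq_pos ha₀ ha₁ hc hadm r hr

end

end ExceptionalMeixner

end

open ExceptionalMeixner in
theorem theorem4p5 {𝕜 : Type*} [RCLike 𝕜] (a c : ℝ) (ha₀ : 0 < a) (ha₁ : a < 1)
    (hc : ∀ j : ℕ, c ≠ -(j : ℝ)) (F₁ F₂ : Finset ℕ)
    (hF₁ : ∀ f ∈ F₁, 0 < f) (hF₂ : ∀ f ∈ F₂, 0 < f) (hF : F₁.Nonempty ∨ F₂.Nonempty)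
    (hadm : Admissible c F₁ F₂) :
    (∀ x : ℕ, 0 < omegaMass a c F₁ F₂ x) ∧
    IsCompleteFamily 𝕜 (omegaMeasure a c F₁ F₂) (sigmaF F₁ F₂) (excMeixner a c F₁ F₂) ∧
    IsOrthogonalFamily (omegaMeasure a c F₁ F₂) (sigmaF F₁ F₂) (excMeixner a c F₁ F₂) ∧
    IsExceptionalMeixner a c F₁ F₂ ∧
    ∀ r ∈ sigmaF F₁ F₂,
      ∫ t, (excMeixner a c F₁ F₂ r).eval t ^ 2 ∂(omegaMeasure a c F₁ F₂) =
        a ^ ((F₁.card : ℤ) - 2 * ((F₁.card : ℤ) + (F₂.card : ℤ))) /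
          (1 - a) ^ (c + 2 * (r : ℝ) - 2 * (uF F₁ F₂ : ℝ) - ((F₁.card + F₂.card : ℕ) : ℝ)) *
          rhoMass a c F₁ F₂ r := by
  have horth := isOrthogonalFamily_excMeixner ha₀ ha₁ hc hadm
  refine ⟨omegaMass_pos ha₀ ha₁ hc hadm, isCompleteFamily_excMeixner ha₀ ha₁ hc hadm 𝕜, horth,
    ⟨_, horth, isCompleteFamily_excMeixner ha₀ ha₁ hc hadm ℝ⟩, fun n hn => ?_⟩
  obtain ⟨r, hr, rfl⟩ := exists_of_mem_sigmaF hn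
  exact integral_excMeixner_sq ha₀ ha₁ hc hadm r hr
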